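/- **Setting.** Fix a time step $k$ and dimensions $n_x\ge 1$, $n_z$. For $d\in\mathbb N$ put $E_d=(\{k\}\times\mathbb R^{d})\uplus(\{k+1\}\times\mathbb R^{d})\uplus(\{k\}\times\mathbb R^{2d})$, with Lebesgue measure on each piece; $T=E_{n_x}$ is the space of two-step trajectories $X$ and $M=E_{n_z}=M^1\uplus M^2\uplus M^3$ the space of trajectory measurements $Z$. Write $\langle a,b\rangle=\int a(X)b(X)\,dX$, and $\int f(\mathbf X)\,\delta\mathbf X=\sum_{\nu\ge0}\frac1{\nu!}\int f(\{X_1,\dots,X_\nu\})\,dX_{1:\nu}$ for functions of finite sets. $\mathcal N(x;\bar x,P)$ is the Gaussian density, and $\mathcal N(X;t,\bar x,P)$ equals $\mathcal N(x_{1:\nu};\bar x,P)$ if $X=(t,x_{1:\nu})$ with $x_{1:\nu}$ of the same dimension as $\bar x$, and $0$ otherwise. *Measurement model.* Let $H\in\mathbb R^{n_z\times n_x}$, let $R\in\mathbb R^{n_z\times n_z}$ be positive definite, $p^D,\tilde p^D\in[0,1]$, $\gamma=\frac12(1-\tilde p^D)$, $H_{1,3}=[1,0]\otimes H$, $H_{2,3}=[0,1]\otimes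 H$, $H_{3,3}=I_2\otimes H$, $H_{1,1}=H_{2,2}=H$, $R_1=R$, $R_2=I_2\otimes R$. Given a set $\mathbf X$ of trajectories, each $X\in\mathbf X$ independently yields one measurement with probability $p^D$, with density $l(Z|X)$, and none otherwise, where $l(Z|X)$ is $\gamma\,\mathcal N(z_1;H_{1,3}x_{1:2},R)$ for $Z=(k,z_1)$, $X=(k,x_{1:2})$; $\gamma\,\mathcal N(z_1;H_{2,3}x_{1:2},R)$ for $Z=(k+1,z_1)$, $X=(k,x_{1:2})$; $\tilde p^D\mathcal N(z_{1:2};H_{3,3}x_{1:2},R_2)$ for $Z=(k,z_{1:2})$, $X=(k,x_{1:2})$; $\mathcal N(z_1;Hx_1,R)$ for $Z=(k,z_1)$, $X=(k,x_1)$ and for $Z=(k+1,z_1)$, $X=(k+1,x_1)$; and $0$ otherwise. Independent clutter is a Poisson point process (PPP) with integrable intensity $\lambda^C\ge0$. Let $L(\mathbf Z|\mathbf X)$ be the resulting density of the measurement set. *PMBM densities.* A PMBM has a PPP intensity $\lambda$, a finite set $\mathcal A$ of global hypotheses $a=(a^i)_i$ with weights $w^a\ge0$, $\sum_a w^a=1$,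 and for each potential target $i$ and single-target hypothesis $a^i$ a Bernoulli density $f^{i,a^i}$ with probability of existence $r^{i,a^i}$ and single-trajectory density $p^{i,a^i}$; its density is $$f(\mathbf X)=\sum_{\mathbf Y\uplus\mathbf W=\mathbf X}e^{-\int\lambda}\prod_{X\in\mathbf Y}\lambda(X)\ \sum_{a\in\mathcal A}w^a\sum_{\uplus_i\mathbf X^i=\mathbf W}\prod_i f^{i,a^i}(\mathbf X^i).$$ *Predicted density.* Let $f$ be a PMBM with potential targets $i=1,\dots,n$, single-target hypotheses $a^i\in\{1,\dots,h^i\}$, global hypotheses $\mathcal A$ with weights $w^a$, intensity $$\lambda(X)=\sum_{q=1}^{n^b}w^{b,q}\mathcal N(X;k+1,\bar x^{b,q},P^{b,q})+\sum_{q=1}^{n^p}w^{p,q}\mathcal N(X;k,\bar x^{p,q},P^{p,q}),\qquad w^{b,q},w^{p,q}\ge0,\ \bar x^{b,q}\in\mathbb R^{n_x},\ \bar x^{p,q}\in\mathbb R^{2n_x},$$ and Bernoulli components with probabilities of existence $r\in[0,1]$ and single-trajectory densities $$p(X)=\sum_{l=1}^{2}\beta(l)\,\mathcal N(X;k,\bar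 x(l),P(l)),\qquad \beta(l)\ge0,\ \beta(1)+\beta(2)=1,\ \bar x(l)\in\mathbb R^{ln_x}\qquad(\ast)$$ (indices $i,a^i$ omitted). All covariance matrices are positive definite, and, as is the case after the prediction step, $\bar x(1)$ and $P(1)$ are the first block of $\bar x(2)$ and the upper left block of $P(2)$. Let $\mathbf Z=\{Z^1,\dots,Z^m\}$ be a set of $m$ distinct trajectory measurements with $\int L(\mathbf Z|\mathbf X)f(\mathbf X)\,\delta\mathbf X\neq0$. **Conclusion.** The updated density $L(\mathbf Z|\mathbf X)f(\mathbf X)\big/\int L(\mathbf Z|\mathbf X')f(\mathbf X')\,\delta\mathbf X'$ is, for every finite $\mathbf X\subset T$, the PMBM density with the following (admissible) parameters. It has $n+m$ potential targets: the old ones, with hypotheses $(\tilde a^i,\text{missed})$ and $(\tilde a^i,Z^j)$, and one new one per measurement, with two hypotheses. Its global hypotheses are the tuples whose underlying tuple $\tilde a=(\tilde a^1,\dots,\tilde a^n)$ lies in $\mathcal A$ and in which each measurement is used by exactly one potential target; their weights are proportional to $w^{\tilde a}$ times the product of the single-target hypothesis weights given below. 1. *Intensity:* $(1-p^D)\lambda(X)$,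 that is, $(1-p^D)\sum_q w^{b,q}\mathcal N(X;k+1,\bar x^{b,q},P^{b,q})+\sum_q (1-p^D)w^{p,q}\mathcal N(X;k,\bar x^{p,q},P^{p,q})$. 2. *Missed detection:* weight $1-rp^D$, probability of existence $r(1-p^D)/(1-rp^D)$, and $\beta(l),\bar x(l),P(l)$ unchanged. 3. *Detection of an existing target by $Z=Z^j$:* probability of existence $1$ and a density of the form $(\ast)$. For a measurement matrix $\mathsf H$ and noise covariance $\mathsf R$ let $S=\mathsf HP\mathsf H^T+\mathsf R$; the Kalman update of $(\bar x,P)$ by $z$ is $\bar x+P\mathsf H^TS^{-1}(z-\mathsf H\bar x)$, $P-P\mathsf H^TS^{-1}\mathsf HP$. - If $Z=(k,z_1)$: weight $r p^D(\beta(1)+\beta(2)\gamma)\,\mathcal N(z_1;H\bar x(1),HP(1)H^T+R)$; the new $\beta(1),\beta(2)$ are proportional to $\beta(1),\beta(2)\gamma$ and sum to one; $(\bar x(1),P(1))$ and $(\bar x(2),P(2))$ are Kalman-updated by $z_1$ with $(H,R)$ and $(H_{1,3},R)$. - If $Z=(k,z_{1:2})$: weight $r p^D\beta(2)\tilde p^D\mathcal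 N(z_{1:2};H_{3,3}\bar x(2),H_{3,3}P(2)H_{3,3}^T+R_2)$; the new $\beta(1),\beta(2)$ are $0,1$; $(\bar x(2),P(2))$ is Kalman-updated by $z_{1:2}$ with $(H_{3,3},R_2)$. - If $Z=(k+1,z_1)$: weight $r p^D\beta(2)\gamma\,\mathcal N(z_1;H_{2,3}\bar x(2),H_{2,3}P(2)H_{2,3}^T+R)$; the new $\beta(1),\beta(2)$ are $0,1$; $(\bar x(2),P(2))$ is Kalman-updated by $z_1$ with $(H_{2,3},R)$. In 2 and 3 the parameters are those of the Bernoulli update: the missed detection weight is $1-r\langle p,p^D\rangle$, its probability of existence is $r\langle p,1-p^D\rangle/(1-r\langle p,p^D\rangle)$ and its density is $(1-p^D)p/\langle p,1-p^D\rangle$; the detection weight is $r\langle p,l(Z|\cdot)p^D\rangle$ and its density is $l(Z|\cdot)p^Dp/\langle p,l(Z|\cdot)p^D\rangle$ (whenever the denominators are nonzero). 4. *New target initiated by $Z=Z^j$:* the hypothesis of no detection has weight $1$ and probability of existence $0$. For the other one, let $v^{b,q}$ and $v^{p,q}$ be the inner products of the $q$-th weighted component of the two mixtures in $\lambda$ with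 $l(Z|\cdot)p^D$. Then $v^{b,q}=w^{b,q}p^D\mathcal N(z_1;H\bar x^{b,q},HP^{b,q}H^T+R)$ if $Z=(k+1,z_1)$, and $v^{b,q}=0$ otherwise; $v^{p,q}=w^{p,q}p^D\gamma\,\mathcal N(z_1;H_{\mu,3}\bar x^{p,q},H_{\mu,3}P^{p,q}H_{\mu,3}^T+R)$ if $Z\in M^\mu$, $\mu\in\{1,2\}$, and $v^{p,q}=w^{p,q}p^D\tilde p^D\mathcal N(z_{1:2};H_{3,3}\bar x^{p,q},H_{3,3}P^{p,q}H_{3,3}^T+R_2)$ if $Z\in M^3$. With $V=\sum_qv^{b,q}+\sum_qv^{p,q}=\langle\lambda,l(Z|\cdot)p^D\rangle$ the weight is $\lambda^C(Z)+V$, the probability of existence is $V/(\lambda^C(Z)+V)$, and, if $V\neq0$, the density is $l(Z|\cdot)p^D\lambda/V$, which is the mixture, with weights $v^{b,q}/V$ and $v^{p,q}/V$, of the Gaussians of $\lambda$ Kalman-updated by $Z$ (with $(H,R)$ for the first mixture, and with $(H_{1,3},R)$, $(H_{2,3},R)$, $(H_{3,3},R_2)$ for the second one and $Z\in M^1,M^2,M^3$).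 5. *Gaussian approximation of the new density:* if $\max_qv^{b,q}>\max_qv^{p,q}$ (respectively $<$), the Gaussian chosen in the implementation, namely the Kalman update of the component of the first (respectively second) mixture that attains this maximum, is a probability density and is the component of highest weight of the exact mixture in 4. -/

import Mathlib

open MeasureTheory
open scoped Matrix Kronecker

noncomputable section

namespace TMPMBM

/-! ## Two-step trajectories and trajectory measurements

The time window consists of the steps `k` and `k+1`. -/

/-- The space `({k} × ℝ^d) ⊎ ({k+1} × ℝ^d) ⊎ ({k} × ℝ^(2d))`. With `d = n_x` it is the space of
two-step trajectories, with `d = n_z` the space of trajectory measurements. A vector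
`x_{1:2} ∈ ℝ^(2d)` is indexed by `Fin 2 × Fin d` (time block, coordinate). -/
inductive TwoStep (d : ℕ) : Type
  /-- `(k, x₁)`: present at time `k` only. -/
  | first (x : Fin d → ℝ) : TwoStep d
  /-- `(k+1, x₁)`: present at time `k+1` only. -/
  | second (x : Fin d → ℝ) : TwoStep d
  /-- `(k, x_{1:2})`: present at both times. -/
  | both (x : Fin 2 × Fin d → ℝ) : TwoStep d

/-- The disjoint-union sigma-algebra. -/
instance (d : ℕ) : MeasurableSpace (TwoStep d) :=
  MeasurableSpace.map TwoStep.first inferInstance ⊓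
    MeasurableSpace.map TwoStep.second inferInstance ⊓
    MeasurableSpace.map TwoStep.both inferInstance

/-- Lebesgue measure on each of the three pieces, so that `∫ X, f X` is the single-trajectory
integral `∫ f(k,x₁) dx₁ + ∫ f(k+1,x₁) dx₁ + ∫ f(k,x_{1:2}) dx_{1:2}`. -/
instance (d : ℕ) : MeasureSpace (TwoStep d) where
  volume := Measure.map TwoStep.first volume + Measure.map TwoStep.second volume +
    Measure.map TwoStep.both volume

/-- The inner product `⟨a, b⟩ = ∫ a(X) b(X) dX`. -/
def innerProd {d : ℕ} (a b : TwoStep d → ℝ) : ℝ := ∫ X, a X * b X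

/-! ## Densities of random finite sets -/

section SetDensities

open scoped Classical

variable {α : Type}

/-- The set integral `∑ₙ (1/n!) ∫ f({X₁,…,Xₙ}) dX_{1:n}`. -/
def setIntegral [MeasureSpace α] (f : Finset α → ℝ) : ℝ :=
  ∑' n : ℕ, ((n.factorial : ℝ))⁻¹ * ∫ X : Fin n → α, f (Finset.univ.image X)

/-- Density of a Poisson point process with intensity `lam`. -/
def pppDensity [MeasureSpace α] (lam : α → ℝ) (S : Finset α) : ℝ :=
  Real.exp (-∫ x, lam x) * ∏ x ∈ S, lam x

/-- Density of a Bernoulli process: `1 - r` at `∅`, `r * p x` at `{x}`, and `0` otherwise. -/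
def bernoulliDensity (r : ℝ) (p : α → ℝ) (S : Finset α) : ℝ :=
  if S = ∅ then 1 - r else if S.card = 1 then r * ∏ x ∈ S, p x else 0

/-- `∑_{Y ⊎ W = S} f(Y) g(W)`. -/
def conv (f g : Finset α → ℝ) (S : Finset α) : ℝ :=
  ∑ Y ∈ S.powerset, f Y * g (S \ Y)

/-- `∑_{⊎ᵢ Sᵢ = S} ∏ᵢ Fᵢ(Sᵢ)`, the sum over all families `(Sᵢ)` of pairwise disjoint, possibly
empty sets with union `S`. Such a family is given by the map `θ` that sends each element of `S`
to the index of the set containing it. -/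
def familyConv {ι : Type} [Fintype ι] (F : ι → Finset α → ℝ) (S : Finset α) : ℝ :=
  ∑ θ : S → ι, ∏ i, F i ((Finset.univ.filter fun s => θ s = i).map (Function.Embedding.subtype _))

end SetDensities

/-- Parameters of a Poisson multi-Bernoulli mixture. Potential targets are indexed by `ι`,
the single-target hypotheses of target `i` by `hyp i`. -/
structure PMBM (d : ℕ) (ι : Type) (hyp : ι → Type) where
  /-- Poisson intensity. -/
  intensity : TwoStep d → ℝ
  /-- The set of global hypotheses. -/
  globalHyp : Finset (∀ i, hyp i)
  /-- Weights of the global hypotheses. -/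
  weight : (∀ i, hyp i) → ℝ
  /-- Probability of existence of each single-target hypothesis. -/
  r : ∀ i, hyp i → ℝ
  /-- Single-trajectory density of each single-target hypothesis. -/
  p : ∀ i, hyp i → TwoStep d → ℝ

namespace PMBM

variable {d : ℕ} {ι : Type} [Fintype ι] {hyp : ι → Type}

/-- The multi-Bernoulli mixture density. -/
def mbmDensity (f : PMBM d ι hyp) (X : Finset (TwoStep d)) : ℝ :=
  ∑ a ∈ f.globalHyp,
    f.weight a * familyConv (fun i => bernoulliDensity (f.r i (a i)) (f.p i (a i))) X

/-- The PMBM density on finite sets of two-step trajectories. -/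
def density (f : PMBM d ι hyp) : Finset (TwoStep d) → ℝ :=
  conv (pppDensity f.intensity) f.mbmDensity

/-- The parameters are admissible: the intensity is nonnegative with finite integral, the global
weights are nonnegative and sum to one, existence probabilities lie in `[0,1]`, and the
single-trajectory densities are probability densities. The latter is required only where the
density contributes (positive global weight and positive probability of existence). -/
structure IsProper (f : PMBM d ι hyp) : Prop where
  intensity_nonneg : ∀ X, 0 ≤ f.intensity X
  intensity_integrable : Integrable f.intensity
  weight_nonneg : ∀ a ∈ f.globalHyp, 0 ≤ f.weight a
  weight_sum : ∑ a ∈ f.globalHyp, f.weight a = 1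
  r_mem : ∀ a ∈ f.globalHyp, ∀ i, f.r i (a i) ∈ Set.Icc (0 : ℝ) 1
  p_nonneg : ∀ a ∈ f.globalHyp, f.weight a ≠ 0 → ∀ i, f.r i (a i) ≠ 0 → ∀ X, 0 ≤ f.p i (a i) X
  p_integral : ∀ a ∈ f.globalHyp, f.weight a ≠ 0 → ∀ i, f.r i (a i) ≠ 0 → ∫ X, f.p i (a i) X = 1

end PMBM

/-! ## Gaussian densities and the Kalman update -/

section Gauss

variable {ι κ : Type} [Fintype ι] [DecidableEq ι] [Fintype κ] [DecidableEq κ]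

/-- The Gaussian density `N(x; μ, P)` on `ℝ^ι`. -/
def gauss (x μ : ι → ℝ) (P : Matrix ι ι ℝ) : ℝ :=
  (Real.sqrt ((2 * Real.pi) ^ Fintype.card ι * P.det))⁻¹ *
    Real.exp (-(1 / 2) * ((x - μ) ⬝ᵥ (P⁻¹ *ᵥ (x - μ))))

/-- Innovation covariance `S = H P Hᵀ + R`. -/
def innovCov (H : Matrix κ ι ℝ) (R : Matrix κ κ ℝ) (P : Matrix ι ι ℝ) : Matrix κ κ ℝ :=
  H * P * Hᵀ + R

/-- Updated mean `μ + P Hᵀ S⁻¹ (z - H μ)`. -/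
def kalmanMean (H : Matrix κ ι ℝ) (R : Matrix κ κ ℝ) (z : κ → ℝ) (μ : ι → ℝ)
    (P : Matrix ι ι ℝ) : ι → ℝ :=
  μ + (P * Hᵀ * (innovCov H R P)⁻¹) *ᵥ (z - H *ᵥ μ)

/-- Updated covariance `P - P Hᵀ S⁻¹ H P`. -/
def kalmanCov (H : Matrix κ ι ℝ) (R : Matrix κ κ ℝ) (P : Matrix ι ι ℝ) : Matrix ι ι ℝ :=
  P - P * Hᵀ * (innovCov H R P)⁻¹ * H * P

end Gauss

variable {nx nz n m nb np : ℕ} {h : Fin n → ℕ}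

/-- `N(X; k, μ, P)` for `μ ∈ ℝ^d`: a Gaussian on the trajectories `(k, x₁)`. -/
def gaussFirst {d : ℕ} (μ : Fin d → ℝ) (P : Matrix (Fin d) (Fin d) ℝ) : TwoStep d → ℝ
  | .first x => gauss x μ P
  | .second _ => 0
  | .both _ => 0

/-- `N(X; k+1, μ, P)` for `μ ∈ ℝ^d`: a Gaussian on the trajectories `(k+1, x₁)`. -/
def gaussSecond {d : ℕ} (μ : Fin d → ℝ) (P : Matrix (Fin d) (Fin d) ℝ) : TwoStep d → ℝ
  | .first _ => 0
  | .second x => gauss x μ P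
  | .both _ => 0

/-- `N(X; k, μ, P)` for `μ ∈ ℝ^(2d)`: a Gaussian on the trajectories `(k, x_{1:2})`. -/
def gaussBoth {d : ℕ} (μ : Fin 2 × Fin d → ℝ) (P : Matrix (Fin 2 × Fin d) (Fin 2 × Fin d) ℝ) :
    TwoStep d → ℝ
  | .first _ => 0
  | .second _ => 0
  | .both x => gauss x μ P

/-! ## Measurement model -/

/-- Linear-Gaussian trajectory-measurement model with constant probability of detection. -/
structure MeasModel (nx nz : ℕ) where
  /-- Measurement matrix of a single state. -/
  H : Matrix (Fin nz) (Fin nx) ℝ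
  /-- Measurement noise covariance of a single state. -/
  R : Matrix (Fin nz) (Fin nz) ℝ
  /-- Probability of detection `p^D`. -/
  pD : ℝ
  /-- Probability that a detected trajectory `(k, x_{1:2})` yields a full measurement. -/
  pFull : ℝ
  /-- Clutter intensity `λ^C`. -/
  clutter : TwoStep nz → ℝ

namespace MeasModel

/-- Standing assumptions on the parameters of the measurement model. -/
structure Valid (M : MeasModel nx nz) : Prop where
  R_posDef : M.R.PosDef
  pD_mem : M.pD ∈ Set.Icc (0 : ℝ) 1
  pFull_mem : M.pFull ∈ Set.Icc (0 : ℝ) 1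
  clutter_nonneg : ∀ Z, 0 ≤ M.clutter Z
  clutter_integrable : Integrable M.clutter

variable (M : MeasModel nx nz)

/-- `γ = (1 - p̃^D) / 2`. -/
def γ : ℝ := (1 - M.pFull) / 2

/-- `H_{1,3} = [1,0] ⊗ H`. -/
def H13 : Matrix (Fin nz) (Fin 2 × Fin nx) ℝ :=
  (!![(1 : ℝ), 0] ⊗ₖ M.H).submatrix (fun i => (0, i)) id

/-- `H_{2,3} = [0,1] ⊗ H`. -/
def H23 : Matrix (Fin nz) (Fin 2 × Fin nx) ℝ :=
  (!![(0 : ℝ), 1] ⊗ₖ M.H).submatrix (fun i => (0, i)) id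

/-- `H_{3,3} = I₂ ⊗ H`. -/
def H33 : Matrix (Fin 2 × Fin nz) (Fin 2 × Fin nx) ℝ :=
  (1 : Matrix (Fin 2) (Fin 2) ℝ) ⊗ₖ M.H

/-- `R₂ = I₂ ⊗ R`. -/
def R2 : Matrix (Fin 2 × Fin nz) (Fin 2 × Fin nz) ℝ :=
  (1 : Matrix (Fin 2) (Fin 2) ℝ) ⊗ₖ M.R

/-- The density `l(Z|X)` of the measurement generated by a detected trajectory. -/
def l : TwoStep nz → TwoStep nx → ℝ
  | .first z, .both x => M.γ * gauss z (M.H13 *ᵥ x) M.R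
  | .second z, .both x => M.γ * gauss z (M.H23 *ᵥ x) M.R
  | .both z, .both x => M.pFull * gauss z (M.H33 *ᵥ x) M.R2
  | .first z, .first x => gauss z (M.H *ᵥ x) M.R
  | .second z, .second x => gauss z (M.H *ᵥ x) M.R
  | _, _ => 0

/-- The function `X ↦ l(Z|X) p^D`. -/
def lpD (Z : TwoStep nz) : TwoStep nx → ℝ := fun X => M.l Z X * M.pD

/-- The density of the set `Z` of measurements given the set `X` of trajectories: `Z` is the
disjoint union of Poisson clutter and of independent sets generated by the trajectories, each of
which yields one measurement with probability `p^D` and none otherwise. -/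
def likelihood (Z : Finset (TwoStep nz)) (X : Finset (TwoStep nx)) : ℝ :=
  conv (pppDensity M.clutter)
    (familyConv fun x : X => bernoulliDensity M.pD fun z => M.l z x) Z

/-- The density of the measurement set `Z` when the trajectory set has density `f`. -/
def evidence (Z : Finset (TwoStep nz)) (f : Finset (TwoStep nx) → ℝ) : ℝ :=
  setIntegral fun X => M.likelihood Z X * f X

/-- The updated density by Bayes' rule, for the prior density `f` and the measurement set `Z`. -/
def posterior (Z : Finset (TwoStep nz)) (f : Finset (TwoStep nx) → ℝ)
    (X : Finset (TwoStep nx)) : ℝ :=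
  M.likelihood Z X * f X / M.evidence Z f

end MeasModel

/-! ## Gaussian form of the predicted density -/

/-- A Bernoulli component with probability of existence `r` and the single-trajectory density
`β(1) N(X; k, x̄(1), P(1)) + β(2) N(X; k, x̄(2), P(2))`. -/
structure GaussBern (nx : ℕ) where
  r : ℝ
  β1 : ℝ
  mean1 : Fin nx → ℝ
  cov1 : Matrix (Fin nx) (Fin nx) ℝ
  β2 : ℝ
  mean2 : Fin 2 × Fin nx → ℝ
  cov2 : Matrix (Fin 2 × Fin nx) (Fin 2 × Fin nx) ℝ

namespace GaussBern

/-- The single-trajectory density. -/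
def density (B : GaussBern nx) (X : TwoStep nx) : ℝ :=
  B.β1 * gaussFirst B.mean1 B.cov1 X + B.β2 * gaussBoth B.mean2 B.cov2 X

/-- Admissible parameters. -/
structure Valid (B : GaussBern nx) : Prop where
  r_mem : B.r ∈ Set.Icc (0 : ℝ) 1
  β1_nonneg : 0 ≤ B.β1
  β2_nonneg : 0 ≤ B.β2
  β_sum : B.β1 + B.β2 = 1
  cov1_posDef : B.cov1.PosDef
  cov2_posDef : B.cov2.PosDef

/-- The two mixture components have the same marginal at time `k`. -/
def SameMarginal (B : GaussBern nx) : Prop :=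
  (∀ i, B.mean2 (0, i) = B.mean1 i) ∧ ∀ i j, B.cov2 (0, i) (0, j) = B.cov1 i j

/-- Weight of the missed detection hypothesis. -/
def missedWeight (M : MeasModel nx nz) (B : GaussBern nx) : ℝ := 1 - B.r * M.pD

/-- Bernoulli component of the missed detection hypothesis. -/
def missed (M : MeasModel nx nz) (B : GaussBern nx) : GaussBern nx :=
  { B with r := B.r * (1 - M.pD) / (1 - B.r * M.pD) }

/-- Weight of the detection hypothesis for the measurement `Z`. -/
def detWeight (M : MeasModel nx nz) (B : GaussBern nx) : TwoStep nz → ℝ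
  | .first z => B.r * M.pD * (B.β1 + B.β2 * M.γ) *
      gauss z (M.H *ᵥ B.mean1) (innovCov M.H M.R B.cov1)
  | .both z => B.r * M.pD * B.β2 * M.pFull *
      gauss z (M.H33 *ᵥ B.mean2) (innovCov M.H33 M.R2 B.cov2)
  | .second z => B.r * M.pD * B.β2 * M.γ *
      gauss z (M.H23 *ᵥ B.mean2) (innovCov M.H23 M.R B.cov2)

/-- Bernoulli component of the detection hypothesis for the measurement `Z`. (If `β(1) = 0`, the
parameters with index `1` are irrelevant and are left unchanged.) -/
def detected (M : MeasModel nx nz) (B : GaussBern nx) : TwoStep nz → GaussBern nx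
  | .first z =>
    { r := 1
      β1 := B.β1 / (B.β1 + B.β2 * M.γ)
      mean1 := kalmanMean M.H M.R z B.mean1 B.cov1
      cov1 := kalmanCov M.H M.R B.cov1
      β2 := B.β2 * M.γ / (B.β1 + B.β2 * M.γ)
      mean2 := kalmanMean M.H13 M.R z B.mean2 B.cov2
      cov2 := kalmanCov M.H13 M.R B.cov2 }
  | .both z =>
    { r := 1
      β1 := 0
      mean1 := B.mean1
      cov1 := B.cov1
      β2 := 1
      mean2 := kalmanMean M.H33 M.R2 z B.mean2 B.cov2
      cov2 := kalmanCov M.H33 M.R2 B.cov2 }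
  | .second z =>
    { r := 1
      β1 := 0
      mean1 := B.mean1
      cov1 := B.cov1
      β2 := 1
      mean2 := kalmanMean M.H23 M.R z B.mean2 B.cov2
      cov2 := kalmanCov M.H23 M.R B.cov2 }

end GaussBern

/-- Parameters of a predicted PMBM with Gaussian-mixture intensity (`nb` components for new born
and `np` components for surviving trajectories) and `n` Gaussian Bernoulli components, the `i`-th
of which has `h i` single-target hypotheses. -/
structure GaussPMBM (nx nb np : ℕ) {n : ℕ} (h : Fin n → ℕ) where
  wB : Fin nb → ℝ
  meanB : Fin nb → Fin nx → ℝ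
  covB : Fin nb → Matrix (Fin nx) (Fin nx) ℝ
  wP : Fin np → ℝ
  meanP : Fin np → Fin 2 × Fin nx → ℝ
  covP : Fin np → Matrix (Fin 2 × Fin nx) (Fin 2 × Fin nx) ℝ
  globalHyp : Finset (∀ i, Fin (h i))
  weight : (∀ i, Fin (h i)) → ℝ
  bern : ∀ i, Fin (h i) → GaussBern nx

/-- Single-target hypotheses after the update with `m` measurements. The potential targets are the
`n` existing ones and one new target per measurement. A hypothesis of an existing target is an old
hypothesis with either a missed detection (`none`) or a detection by measurement `j` (`some j`).
A new target is either not detected (`false`) or detected (`true`). -/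
def LocalHyp (h : Fin n → ℕ) (m : ℕ) : Fin n ⊕ Fin m → Type
  | .inl i => Fin (h i) × Option (Fin m)
  | .inr _ => Bool

instance (h : Fin n → ℕ) (m : ℕ) (t : Fin n ⊕ Fin m) : Fintype (LocalHyp h m t) :=
  match t with
  | .inl i => inferInstanceAs (Fintype (Fin (h i) × Option (Fin m)))
  | .inr _ => inferInstanceAs (Fintype Bool)

/-- Measurement `j` is used by a single-target hypothesis. -/
def LocalHyp.Uses (j : Fin m) : (t : Fin n ⊕ Fin m) → LocalHyp h m t → Prop
  | .inl _, a => Prod.snd a = some j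
  | .inr j', a => j = j' ∧ (show Bool from a) = true

/-- The global hypothesis of the predicted density underlying an updated one. -/
def parent (a : ∀ t, LocalHyp h m t) (i : Fin n) : Fin (h i) := Prod.fst (a (.inl i))

namespace GaussPMBM

/-- Admissible parameters. -/
structure Valid (P : GaussPMBM nx nb np h) : Prop where
  wB_nonneg : ∀ q, 0 ≤ P.wB q
  covB_posDef : ∀ q, (P.covB q).PosDef
  wP_nonneg : ∀ q, 0 ≤ P.wP q
  covP_posDef : ∀ q, (P.covP q).PosDef
  weight_nonneg : ∀ a ∈ P.globalHyp, 0 ≤ P.weight a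
  weight_sum : ∑ a ∈ P.globalHyp, P.weight a = 1
  bern_valid : ∀ i a, (P.bern i a).Valid

variable (P : GaussPMBM nx nb np h) (M : MeasModel nx nz)

/-- The `c`-th weighted component of the Poisson intensity. -/
def intensityComp : Fin nb ⊕ Fin np → TwoStep nx → ℝ
  | .inl q => fun X => P.wB q * gaussSecond (P.meanB q) (P.covB q) X
  | .inr q => fun X => P.wP q * gaussBoth (P.meanP q) (P.covP q) X

/-- The predicted PMBM. -/
def predicted : PMBM nx (Fin n) (fun i => Fin (h i)) where
  intensity X := ∑ q, P.wB q * gaussSecond (P.meanB q) (P.covB q) X +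
    ∑ q, P.wP q * gaussBoth (P.meanP q) (P.covP q) X
  globalHyp := P.globalHyp
  weight := P.weight
  r i a := (P.bern i a).r
  p i a := (P.bern i a).density

/-- The inner products `v^{b,q}` and `v^{p,q}`. -/
def v (Z : TwoStep nz) (c : Fin nb ⊕ Fin np) : ℝ :=
  match c, Z with
  | .inl q, .second z => P.wB q * M.pD *
      gauss z (M.H *ᵥ P.meanB q) (innovCov M.H M.R (P.covB q))
  | .inl _, .first _ => 0
  | .inl _, .both _ => 0
  | .inr q, .first z => P.wP q * M.pD * M.γ *
      gauss z (M.H13 *ᵥ P.meanP q) (innovCov M.H13 M.R (P.covP q))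
  | .inr q, .second z => P.wP q * M.pD * M.γ *
      gauss z (M.H23 *ᵥ P.meanP q) (innovCov M.H23 M.R (P.covP q))
  | .inr q, .both z => P.wP q * M.pD * M.pFull *
      gauss z (M.H33 *ᵥ P.meanP q) (innovCov M.H33 M.R2 (P.covP q))

/-- Kalman update, by the measurement `Z`, of the `c`-th Gaussian of the Poisson intensity. (New
born trajectories can only be detected by measurements `(k+1, z₁)`; in the other cases
`v^{b,q} = 0` and the Gaussian is left unchanged.) -/
def newComp (Z : TwoStep nz) (c : Fin nb ⊕ Fin np) : TwoStep nx → ℝ :=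
  match c, Z with
  | .inl q, .second z => gaussSecond
      (kalmanMean M.H M.R z (P.meanB q) (P.covB q)) (kalmanCov M.H M.R (P.covB q))
  | .inl q, .first _ => gaussSecond (P.meanB q) (P.covB q)
  | .inl q, .both _ => gaussSecond (P.meanB q) (P.covB q)
  | .inr q, .first z => gaussBoth
      (kalmanMean M.H13 M.R z (P.meanP q) (P.covP q)) (kalmanCov M.H13 M.R (P.covP q))
  | .inr q, .second z => gaussBoth
      (kalmanMean M.H23 M.R z (P.meanP q) (P.covP q)) (kalmanCov M.H23 M.R (P.covP q))
  | .inr q, .both z => gaussBoth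
      (kalmanMean M.H33 M.R2 z (P.meanP q) (P.covP q)) (kalmanCov M.H33 M.R2 (P.covP q))

/-- `∑_q v^{b,q} + ∑_q v^{p,q}`. -/
def vSum (Z : TwoStep nz) : ℝ := ∑ q, P.v M Z (.inl q) + ∑ q, P.v M Z (.inr q)

/-- Weight of the detection hypothesis of the new Bernoulli component initiated by `Z`. -/
def newWeight (Z : TwoStep nz) : ℝ := M.clutter Z + P.vSum M Z

/-- Probability of existence of the new Bernoulli component initiated by `Z`. -/
def newR (Z : TwoStep nz) : ℝ := P.vSum M Z / P.newWeight M Z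

/-- Single-trajectory density of the new Bernoulli component initiated by `Z`: the mixture of
Kalman-updated Gaussians with weights proportional to `v^{b,q}` and `v^{p,q}`. -/
def newDensity (Z : TwoStep nz) (X : TwoStep nx) : ℝ :=
  ∑ c, P.v M Z c / P.vSum M Z * P.newComp M Z c X

/-- `g` is the single Gaussian that replaces the mixture `newDensity` in the implementation.
If the largest `v^{b,q}`, attained at `q`, exceeds all `v^{p,q'}`, it is the Kalman update of the
`q`-th new born Gaussian; if the largest `v^{p,q}`, attained at `q`, exceeds all `v^{b,q'}`, it is
the Kalman update of the `q`-th surviving Gaussian. -/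
def IsGaussianApprox (Z : TwoStep nz) (g : TwoStep nx → ℝ) : Prop :=
  (∃ q, (∀ q', P.v M Z (.inl q') ≤ P.v M Z (.inl q)) ∧
      (∀ q', P.v M Z (.inr q') < P.v M Z (.inl q)) ∧ g = P.newComp M Z (.inl q)) ∨
    (∃ q, (∀ q', P.v M Z (.inr q') ≤ P.v M Z (.inr q)) ∧
      (∀ q', P.v M Z (.inl q') < P.v M Z (.inr q)) ∧ g = P.newComp M Z (.inr q))

/-- Weight of a single-target hypothesis after the update. -/
def localWeight (Z : Fin m → TwoStep nz) : (t : Fin n ⊕ Fin m) → LocalHyp h m t → ℝ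
  | .inl i, (a, none) => (P.bern i a).missedWeight M
  | .inl i, (a, some j) => (P.bern i a).detWeight M (Z j)
  | .inr _, false => 1
  | .inr j, true => P.newWeight M (Z j)

/-- Probability of existence of a single-target hypothesis after the update. -/
def localR (Z : Fin m → TwoStep nz) : (t : Fin n ⊕ Fin m) → LocalHyp h m t → ℝ
  | .inl i, (a, none) => ((P.bern i a).missed M).r
  | .inl i, (a, some j) => ((P.bern i a).detected M (Z j)).r
  | .inr _, false => 0
  | .inr j, true => P.newR M (Z j)

/-- Single-trajectory density of a single-target hypothesis after the update. (It is irrelevant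
for an undetected new target, whose probability of existence is zero.) -/
def localDensity (Z : Fin m → TwoStep nz) :
    (t : Fin n ⊕ Fin m) → LocalHyp h m t → TwoStep nx → ℝ
  | .inl i, (a, none) => ((P.bern i a).missed M).density
  | .inl i, (a, some j) => ((P.bern i a).detected M (Z j)).density
  | .inr _, false => fun _ => 0
  | .inr j, true => P.newDensity M (Z j)

open scoped Classical in
/-- Updated global hypotheses: those that extend a predicted global hypothesis and associate each
measurement with exactly one potential target. -/
def updatedHyp (m : ℕ) : Finset (∀ t, LocalHyp h m t) :=
  Finset.univ.filter fun a => parent a ∈ P.globalHyp ∧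
    ∀ j : Fin m, ∃! t, LocalHyp.Uses j t (a t)

/-- Weight of an updated global hypothesis before normalisation. -/
def rawWeight (Z : Fin m → TwoStep nz) (a : ∀ t, LocalHyp h m t) : ℝ :=
  P.weight (parent a) * ∏ t, P.localWeight M Z t (a t)

/-- The updated PMBM. -/
def updated (Z : Fin m → TwoStep nz) : PMBM nx (Fin n ⊕ Fin m) (LocalHyp h m) where
  intensity X := (1 - M.pD) * ∑ q, P.wB q * gaussSecond (P.meanB q) (P.covB q) X +
    ∑ q, ((1 - M.pD) * P.wP q) * gaussBoth (P.meanP q) (P.covP q) X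
  globalHyp := P.updatedHyp m
  weight a := P.rawWeight M Z a / ∑ a' ∈ P.updatedHyp m, P.rawWeight M Z a'
  r := P.localR M Z
  p := P.localDensity M Z

end GaussPMBM

end TMPMBM

end

/-! Set densities are encoded as elements of a commutative ring. Attach to each point `x` a variable
`e x` with `e x * e x = 0` and to a set function `F` the element `gen e X F`. Overlapping subsets
multiply to zero, so sums over disjoint decompositions become products (`gen_mul_gen`, `prod_gen`):
a PPP becomes `∏ (1 + λ(x) e x)` up to a constant, a Bernoulli component becomes the affine element
`(1 - r) + ∑ r p(x) e x`, and a PMBM is a weighted sum of products of these. The coefficient of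
`∏_{x ∈ X} e x` recovers `F X`.

The measurements get square-zero variables `Y j` as well. As a function of the measurement set, the
likelihood has a generating element equal to the clutter factor times `∏_{x ∈ X} c x`, where `c x =
(1 - pD) + ∑_j l(Z j|x) pD Y j`. Hence likelihood times prior is the top coefficient, in both
families of variables, of the clutter factor times the prior element with `e x` replaced by `c x * e
x` (`likelihood_mul_density`).

This substitution acts factor by factor. A Bernoulli factor becomes the sum of its missed detection
and of its detections by each `Z j` (`sum_localGen_existing`). The Poisson factor together with the
clutter splits into a thinned Poisson factor and one factor per measurement, which is the new target
(`poisson_thinning`, `sum_localGen_new`). Multiplying out produces one term per choice of local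
hypotheses (`joint_gen`), and the top coefficient in `Y` keeps the choices that use every
measurement exactly once.

The normaliser follows because each Poisson multi-Bernoulli term has set integral one
(`hasUnitSetIntegral_pmb`), so the evidence is a constant times the total raw weight. The
closed-form parameters rest on a single Gaussian identity, `gauss_mul_gauss`: likelihood times prior
equals predictive density times Kalman-updated density. It comes from completing the square and a
determinant identity. -/

noncomputable section

namespace TMPMBM

/-! ### Gaussian densities: the Kalman product identity and normalisation. -/

section GaussianIdentities

variable {ι κ : Type} [Fintype ι] [DecidableEq ι] [Fintype κ] [DecidableEq κ]

omit [DecidableEq ι] [DecidableEq κ] in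
theorem innovCov_posDef {H : Matrix κ ι ℝ} {R : Matrix κ κ ℝ} {P : Matrix ι ι ℝ}
    (hR : R.PosDef) (hP : P.PosDef) : (innovCov H R P).PosDef := by
  have h := hP.posSemidef.mul_mul_conjTranspose_same H
  rw [Matrix.conjTranspose_eq_transpose_of_trivial] at h
  exact hR.posSemidef_add h

/-- Information form of the updated covariance. -/
theorem kalmanCov_eq_inv {H : Matrix κ ι ℝ} {R : Matrix κ κ ℝ} {P : Matrix ι ι ℝ}
    (hR : R.PosDef) (hP : P.PosDef) : kalmanCov H R P = (P⁻¹ + Hᵀ * R⁻¹ * H)⁻¹ := by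
  -- The Woodbury identity is applied with `P⁻¹` and `R⁻¹` as base matrices, so its invertibility
  -- condition appears with double inverses; it is the invertibility of the innovation covariance.
  have hS : IsUnit (R⁻¹⁻¹ + H * P⁻¹⁻¹ * Hᵀ) := by
    rw [Matrix.nonsing_inv_nonsing_inv _ ((Matrix.isUnit_iff_isUnit_det _).1 hR.isUnit),
      Matrix.nonsing_inv_nonsing_inv _ ((Matrix.isUnit_iff_isUnit_det _).1 hP.isUnit), add_comm]
    exact (innovCov_posDef hR hP).isUnit
  rw [Matrix.add_mul_mul_inv_eq_sub _ _ _ _ hP.inv.isUnit hR.inv.isUnit hS,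
    Matrix.nonsing_inv_nonsing_inv _ ((Matrix.isUnit_iff_isUnit_det _).1 hR.isUnit),
    Matrix.nonsing_inv_nonsing_inv _ ((Matrix.isUnit_iff_isUnit_det _).1 hP.isUnit),
    kalmanCov, innovCov, add_comm R]

theorem information_posDef {H : Matrix κ ι ℝ} {R : Matrix κ κ ℝ} {P : Matrix ι ι ℝ}
    (hR : R.PosDef) (hP : P.PosDef) : (P⁻¹ + Hᵀ * R⁻¹ * H).PosDef := by
  have h := hR.inv.posSemidef.conjTranspose_mul_mul_same H
  rw [Matrix.conjTranspose_eq_transpose_of_trivial] at h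
  exact hP.inv.add_posSemidef h

theorem kalmanCov_posDef {H : Matrix κ ι ℝ} {R : Matrix κ κ ℝ} {P : Matrix ι ι ℝ}
    (hR : R.PosDef) (hP : P.PosDef) : (kalmanCov H R P).PosDef := by
  rw [kalmanCov_eq_inv hR hP]
  exact (information_posDef hR hP).inv

/-- Sylvester's identity `det (1 + A B) = det (1 + B A)` with `A = R⁻¹ H` and `B = P Hᵀ`: the
innovation covariance is `R (1 + A B)` and the information matrix is `P⁻¹ (1 + B A)`. It matches the
normalising constants in `gauss_mul_gauss`. -/
theorem det_innovCov_mul_det_kalmanCov {H : Matrix κ ι ℝ} {R : Matrix κ κ ℝ} {P : Matrix ι ι ℝ}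
    (hR : R.PosDef) (hP : P.PosDef) :
    (innovCov H R P).det * (kalmanCov H R P).det = R.det * P.det := by
  have hRu := (Matrix.isUnit_iff_isUnit_det _).1 hR.isUnit
  have hPu := (Matrix.isUnit_iff_isUnit_det _).1 hP.isUnit
  have h1 : innovCov H R P = R * (1 + (R⁻¹ * H) * (P * Hᵀ)) := by
    rw [mul_add, mul_one, ← Matrix.mul_assoc R, ← Matrix.mul_assoc R, Matrix.mul_nonsing_inv _ hRu,
      Matrix.one_mul, innovCov, add_comm, Matrix.mul_assoc]
  have h2 : P⁻¹ + Hᵀ * R⁻¹ * H = P⁻¹ * (1 + (P * Hᵀ) * (R⁻¹ * H)) := by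
    rw [mul_add, mul_one, ← Matrix.mul_assoc P⁻¹, ← Matrix.mul_assoc P⁻¹,
      Matrix.nonsing_inv_mul _ hPu, Matrix.one_mul, Matrix.mul_assoc]
  have hJ := (information_posDef (H := H) hR hP).det_pos.ne'
  rw [kalmanCov_eq_inv hR hP, Matrix.det_nonsing_inv, Ring.inverse_eq_inv', ← div_eq_mul_inv,
    div_eq_iff hJ, h1, h2, Matrix.det_mul, Matrix.det_mul, Matrix.det_nonsing_inv,
    Ring.inverse_eq_inv', Matrix.det_one_add_mul_comm]
  field_simp [hP.det_pos.ne']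

omit [DecidableEq ι] [DecidableEq κ] in
theorem transpose_mulVec_dotProduct (A : Matrix κ ι ℝ) (v : κ → ℝ) (w : ι → ℝ) :
    (Aᵀ *ᵥ v) ⬝ᵥ w = v ⬝ᵥ (A *ᵥ w) := by
  rw [Matrix.mulVec_transpose, Matrix.dotProduct_mulVec]

theorem inv_transpose_of_posDef {P : Matrix ι ι ℝ} (hP : P.PosDef) : P⁻¹ᵀ = P⁻¹ := by
  have := hP.inv.isHermitian
  rwa [Matrix.IsHermitian, Matrix.conjTranspose_eq_transpose_of_trivial] at this

omit [Fintype ι] [DecidableEq ι] in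
theorem transpose_of_posDef {P : Matrix ι ι ℝ} (hP : P.PosDef) : Pᵀ = P := by
  have := hP.isHermitian
  rwa [Matrix.IsHermitian, Matrix.conjTranspose_eq_transpose_of_trivial] at this

/-- Completing the square in the Kalman update. -/
theorem kalman_quadratic {H : Matrix κ ι ℝ} {R : Matrix κ κ ℝ} {P : Matrix ι ι ℝ}
    (hR : R.PosDef) (hP : P.PosDef) (u : ι → ℝ) (w : κ → ℝ) :
    (w - H *ᵥ u) ⬝ᵥ (R⁻¹ *ᵥ (w - H *ᵥ u)) + u ⬝ᵥ (P⁻¹ *ᵥ u) =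
      w ⬝ᵥ ((innovCov H R P)⁻¹ *ᵥ w) +
        (u - (P * Hᵀ * (innovCov H R P)⁻¹) *ᵥ w) ⬝ᵥ
          ((kalmanCov H R P)⁻¹ *ᵥ (u - (P * Hᵀ * (innovCov H R P)⁻¹) *ᵥ w)) := by
  have hRu := (Matrix.isUnit_iff_isUnit_det _).1 hR.isUnit
  have hPu := (Matrix.isUnit_iff_isUnit_det _).1 hP.isUnit
  have hSpos := innovCov_posDef (H := H) hR hP
  have hSu := (Matrix.isUnit_iff_isUnit_det _).1 hSpos.isUnit
  have hJ := information_posDef (H := H) hR hP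
  have hJu := (Matrix.isUnit_iff_isUnit_det _).1 hJ.isUnit
  rw [kalmanCov_eq_inv hR hP, Matrix.nonsing_inv_nonsing_inv _ hJu]
  set S := innovCov H R P with hS
  set G := P * Hᵀ * S⁻¹ with hG
  set J := P⁻¹ + Hᵀ * R⁻¹ * H with hJd
  -- The gain `G` in information form; this makes the cross terms in `u` and `w` agree on both
  -- sides.
  have hJG : J * G = Hᵀ * R⁻¹ := by
    have h1 : J * (P * Hᵀ) = Hᵀ * R⁻¹ * S := by
      rw [hJd, hS, innovCov, Matrix.add_mul, Matrix.mul_add, ← Matrix.mul_assoc, Matrix.nonsing_inv_mul _ hPu,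
        Matrix.one_mul, Matrix.mul_assoc (Hᵀ) R⁻¹ R, Matrix.nonsing_inv_mul _ hRu, Matrix.mul_one,
        add_comm]
      simp only [Matrix.mul_assoc]
    rw [hG, ← Matrix.mul_assoc, h1, Matrix.mul_assoc, Matrix.mul_nonsing_inv _ hSu, Matrix.mul_one]
  -- This accounts for the terms quadratic in `w`: what the updated Gaussian absorbs is the
  -- difference between `R⁻¹` and `S⁻¹`.
  have hHG : R⁻¹ * (H * G) = R⁻¹ - S⁻¹ := by
    have h1 : H * G = (S - R) * S⁻¹ := by
      rw [hG, hS, innovCov, add_sub_cancel_right]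
      simp only [Matrix.mul_assoc]
    rw [h1, sub_mul, Matrix.mul_nonsing_inv _ hSu, mul_sub, Matrix.mul_one, ← Matrix.mul_assoc,
      Matrix.nonsing_inv_mul _ hRu, Matrix.one_mul]
  have hRt := inv_transpose_of_posDef hR
  have e1 : u ⬝ᵥ (J *ᵥ u) = u ⬝ᵥ (P⁻¹ *ᵥ u) + (H *ᵥ u) ⬝ᵥ (R⁻¹ *ᵥ (H *ᵥ u)) := by
    rw [hJd, Matrix.add_mulVec, dotProduct_add, ← Matrix.mulVec_mulVec, ← Matrix.mulVec_mulVec,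
      dotProduct_comm u (Hᵀ *ᵥ _), transpose_mulVec_dotProduct, dotProduct_comm (R⁻¹ *ᵥ _)]
  have e2 : J *ᵥ (G *ᵥ w) = Hᵀ *ᵥ (R⁻¹ *ᵥ w) := by
    rw [Matrix.mulVec_mulVec, hJG, Matrix.mulVec_mulVec]
  have e3 : u ⬝ᵥ (J *ᵥ (G *ᵥ w)) = (R⁻¹ *ᵥ w) ⬝ᵥ (H *ᵥ u) := by
    rw [e2, dotProduct_comm, transpose_mulVec_dotProduct]
  have e4 : (G *ᵥ w) ⬝ᵥ (J *ᵥ u) = (R⁻¹ *ᵥ w) ⬝ᵥ (H *ᵥ u) := by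
    rw [← transpose_mulVec_dotProduct, transpose_of_posDef hJ, e2, transpose_mulVec_dotProduct]
  have e5 : (G *ᵥ w) ⬝ᵥ (J *ᵥ (G *ᵥ w)) = w ⬝ᵥ (R⁻¹ *ᵥ w) - w ⬝ᵥ (S⁻¹ *ᵥ w) := by
    rw [e2, dotProduct_comm, transpose_mulVec_dotProduct, ← dotProduct_sub,
      ← Matrix.sub_mulVec, ← hHG]
    nth_rw 1 [← hRt]
    rw [transpose_mulVec_dotProduct]
    simp only [Matrix.mulVec_mulVec]
  have e6 : w ⬝ᵥ (R⁻¹ *ᵥ (H *ᵥ u)) = (R⁻¹ *ᵥ w) ⬝ᵥ (H *ᵥ u) := by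
    rw [← transpose_mulVec_dotProduct, hRt]
  have e7 : (H *ᵥ u) ⬝ᵥ (R⁻¹ *ᵥ w) = (R⁻¹ *ᵥ w) ⬝ᵥ (H *ᵥ u) := dotProduct_comm _ _
  simp only [Matrix.mulVec_sub, dotProduct_sub, sub_dotProduct, e1, e3, e4, e5, e6, e7]
  ring

/-- The Kalman update as an identity between Gaussian densities. -/
theorem gauss_mul_gauss {H : Matrix κ ι ℝ} {R : Matrix κ κ ℝ} {P : Matrix ι ι ℝ}
    (hR : R.PosDef) (hP : P.PosDef) (x μ : ι → ℝ) (z : κ → ℝ) :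
    gauss z (H *ᵥ x) R * gauss x μ P =
      gauss z (H *ᵥ μ) (innovCov H R P) *
        gauss x (kalmanMean H R z μ P) (kalmanCov H R P) := by
  have hSpos := innovCov_posDef (H := H) hR hP
  have hKpos := kalmanCov_posDef (H := H) hR hP
  have hq := kalman_quadratic (H := H) hR hP (x - μ) (z - H *ᵥ μ)
  have h1 : z - H *ᵥ μ - H *ᵥ (x - μ) = z - H *ᵥ x := by
    rw [Matrix.mulVec_sub]; abel
  have h2 : x - μ - (P * Hᵀ * (innovCov H R P)⁻¹) *ᵥ (z - H *ᵥ μ) = x - kalmanMean H R z μ P := by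
    rw [kalmanMean]; abel
  rw [h1, h2] at hq
  have hdet := det_innovCov_mul_det_kalmanCov (H := H) hR hP
  simp only [gauss]
  rw [mul_mul_mul_comm, ← Real.exp_add, mul_mul_mul_comm, ← Real.exp_add, ← mul_inv, ← mul_inv,
    ← Real.sqrt_mul (by have := hR.det_pos; positivity),
    ← Real.sqrt_mul (by have := hSpos.det_pos; positivity), ← mul_add, ← mul_add, hq,
    mul_mul_mul_comm, mul_mul_mul_comm (_ ^ _) (innovCov H R P).det, hdet]

theorem gauss_nonneg (x μ : ι → ℝ) (P : Matrix ι ι ℝ) : 0 ≤ gauss x μ P := by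
  unfold gauss; positivity

/-- Linear change of variables. No measurability of `f` is needed because an invertible linear map
is a measurable embedding. -/
theorem integral_comp_mulVec {B : Matrix ι ι ℝ} (hB : B.det ≠ 0) (f : (ι → ℝ) → ℝ) :
    ∫ x, f (B *ᵥ x) = |B.det|⁻¹ * ∫ x, f x := by
  have hemb : MeasurableEmbedding (Matrix.toLin' B) :=
    (((LinearEquiv.ofIsUnitDet (f := Matrix.toLin' B) (v := Pi.basisFun ℝ ι) (v' := Pi.basisFun ℝ ι)
      (by simpa using hB)).toContinuousLinearEquiv).toHomeomorph.measurableEmbedding :)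
  have h := hemb.integral_map (μ := volume) f
  rw [Real.map_matrix_volume_pi_eq_smul_volume_pi hB, integral_smul_measure,
    ENNReal.toReal_ofReal (abs_nonneg _), abs_inv] at h
  simpa using h.symm

omit [DecidableEq ι] in
theorem integral_exp_neg_half_dotProduct :
    ∫ x : ι → ℝ, Real.exp (-(1 / 2) * (x ⬝ᵥ x)) = Real.sqrt ((2 * Real.pi) ^ Fintype.card ι) := by
  have h : ∀ x : ι → ℝ, Real.exp (-(1 / 2) * (x ⬝ᵥ x)) =
      ∏ i, Real.exp (-(1 / 2) * x i ^ 2) := by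
    intro x
    rw [← Real.exp_sum, dotProduct, Finset.mul_sum]
    simp only [pow_two]
  simp_rw [h]
  rw [integral_fintype_prod_volume_eq_pow (fun y : ℝ => Real.exp (-(1 / 2) * y ^ 2)),
    integral_gaussian, show Real.pi / (1 / 2) = 2 * Real.pi by ring]
  nth_rw 2 [← Real.sq_sqrt (show (0 : ℝ) ≤ 2 * Real.pi by positivity)]
  rw [pow_right_comm, Real.sqrt_sq (by positivity)]

open scoped MatrixOrder in
theorem exists_factor_of_posDef {A : Matrix ι ι ℝ} (hA : A.PosDef) :
    ∃ B : Matrix ι ι ℝ, A = Bᵀ * B := by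
  obtain ⟨B, hB⟩ := (CStarAlgebra.nonneg_iff_eq_star_mul_self (a := A)).1
    (Matrix.nonneg_iff_posSemidef.2 hA.posSemidef)
  exact ⟨B, by rwa [Matrix.star_eq_conjTranspose,
    Matrix.conjTranspose_eq_transpose_of_trivial] at hB⟩

/-- Whitening: with `P⁻¹ = Bᵀ B`, the substitution `y ↦ B y` turns the exponent into that of a
product of standard Gaussians, and `|det B|⁻¹ = √(det P)` cancels the normalising constant. -/
theorem integral_gauss {P : Matrix ι ι ℝ} (hP : P.PosDef) (μ : ι → ℝ) :
    ∫ x, gauss x μ P = 1 := by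
  obtain ⟨B, hB⟩ := exists_factor_of_posDef hP.inv
  have hdet : B.det ^ 2 = P.det⁻¹ := by
    rw [← Ring.inverse_eq_inv', ← Matrix.det_nonsing_inv, hB, Matrix.det_mul,
      Matrix.det_transpose, sq]
  have hBne : B.det ≠ 0 := by
    intro h0
    rw [h0] at hdet
    have := inv_pos.2 hP.det_pos
    simp [← hdet] at this
  have hq : ∀ y : ι → ℝ, y ⬝ᵥ (P⁻¹ *ᵥ y) = (B *ᵥ y) ⬝ᵥ (B *ᵥ y) := by
    intro y
    rw [hB, ← Matrix.mulVec_mulVec, dotProduct_comm, transpose_mulVec_dotProduct]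
  simp only [gauss]
  rw [integral_const_mul,
    integral_sub_right_eq_self (fun y : ι → ℝ => Real.exp (-(1 / 2) * (y ⬝ᵥ (P⁻¹ *ᵥ y)))) μ]
  simp_rw [hq]
  rw [integral_comp_mulVec hBne fun y => Real.exp (-(1 / 2) * (y ⬝ᵥ y)),
    integral_exp_neg_half_dotProduct, Real.sqrt_mul (by positivity), ← Real.sqrt_sq_eq_abs, hdet,
    Real.sqrt_inv, inv_inv]
  have h1 : Real.sqrt ((2 * Real.pi) ^ Fintype.card ι) ≠ 0 := by positivity
  have h2 : Real.sqrt P.det ≠ 0 := (Real.sqrt_pos.2 hP.det_pos).ne'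
  field_simp

/-- The Bochner integral of a non-integrable function is zero by convention, so an integral equal to
one already forces integrability. -/
theorem integrable_gauss {P : Matrix ι ι ℝ} (hP : P.PosDef) (μ : ι → ℝ) :
    Integrable fun x => gauss x μ P := by
  by_contra hc
  have := integral_gauss hP μ
  rw [integral_undef hc] at this
  exact zero_ne_one this

end GaussianIdentities

/-! ### Measure theory on the disjoint union of trajectory spaces. -/

section TwoStepMeasure

variable {d : ℕ}

theorem TwoStep.measurableSet_iff {s : Set (TwoStep d)} :
    MeasurableSet s ↔ MeasurableSet (TwoStep.first ⁻¹' s) ∧ MeasurableSet (TwoStep.second ⁻¹' s) ∧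
      MeasurableSet (TwoStep.both ⁻¹' s) := by
  rw [← and_assoc]
  -- Measurability for the infimum of the three pushforward sigma-algebras unfolds to measurability
  -- of the three preimages.
  exact Iff.rfl

theorem TwoStep.measurable_iff {β : Type*} [MeasurableSpace β] {f : TwoStep d → β} :
    Measurable f ↔ Measurable (fun x => f (.first x)) ∧ Measurable (fun x => f (.second x)) ∧
      Measurable (fun x => f (.both x)) := by
  constructor
  · intro h
    exact ⟨fun s hs => (TwoStep.measurableSet_iff.1 (h hs)).1,
      fun s hs => (TwoStep.measurableSet_iff.1 (h hs)).2.1,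
      fun s hs => (TwoStep.measurableSet_iff.1 (h hs)).2.2⟩
  · rintro ⟨h1, h2, h3⟩ s hs
    exact TwoStep.measurableSet_iff.2 ⟨h1 hs, h2 hs, h3 hs⟩

theorem TwoStep.measurableEmbedding_first : MeasurableEmbedding (TwoStep.first (d := d)) where
  injective _ _ h := TwoStep.first.inj h
  measurable := (TwoStep.measurable_iff.1 measurable_id).1
  measurableSet_image' s hs := by
    refine TwoStep.measurableSet_iff.2 ⟨?_, ?_, ?_⟩
    · rwa [Set.preimage_image_eq _ fun _ _ h => TwoStep.first.inj h]
    · convert MeasurableSet.empty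
      ext; simp
    · convert MeasurableSet.empty
      ext; simp

theorem TwoStep.measurableEmbedding_second : MeasurableEmbedding (TwoStep.second (d := d)) where
  injective _ _ h := TwoStep.second.inj h
  measurable := (TwoStep.measurable_iff.1 measurable_id).2.1
  measurableSet_image' s hs := by
    refine TwoStep.measurableSet_iff.2 ⟨?_, ?_, ?_⟩
    · convert MeasurableSet.empty
      ext; simp
    · rwa [Set.preimage_image_eq _ fun _ _ h => TwoStep.second.inj h]
    · convert MeasurableSet.empty
      ext; simp

theorem TwoStep.measurableEmbedding_both : MeasurableEmbedding (TwoStep.both (d := d)) where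
  injective _ _ h := TwoStep.both.inj h
  measurable := (TwoStep.measurable_iff.1 measurable_id).2.2
  measurableSet_image' s hs := by
    refine TwoStep.measurableSet_iff.2 ⟨?_, ?_, ?_⟩
    · convert MeasurableSet.empty
      ext; simp
    · convert MeasurableSet.empty
      ext; simp
    · rwa [Set.preimage_image_eq _ fun _ _ h => TwoStep.both.inj h]

theorem TwoStep.volume_eq : (volume : Measure (TwoStep d)) =
    Measure.map TwoStep.first volume + Measure.map TwoStep.second volume +
      Measure.map TwoStep.both volume := rfl

instance : SigmaFinite (volume : Measure (TwoStep d)) := by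
  have h1 := (TwoStep.measurableEmbedding_first (d := d)).sigmaFinite_map (μ := volume)
  have h2 := (TwoStep.measurableEmbedding_second (d := d)).sigmaFinite_map (μ := volume)
  have h3 := (TwoStep.measurableEmbedding_both (d := d)).sigmaFinite_map (μ := volume)
  rw [TwoStep.volume_eq]
  infer_instance

/-- Each piece is a Euclidean space of positive dimension, hence atomless. For `d = 0` the pieces
would be single points of mass one. -/
theorem TwoStep.nullSingletonClass (hd : 0 < d) :
    NullSingletonClass (volume : Measure (TwoStep d)) := by
  have : Nonempty (Fin d) := ⟨⟨0, hd⟩⟩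
  refine ⟨fun x => ?_⟩
  rw [TwoStep.volume_eq, Measure.add_apply, Measure.add_apply,
    TwoStep.measurableEmbedding_first.map_apply, TwoStep.measurableEmbedding_second.map_apply,
    TwoStep.measurableEmbedding_both.map_apply,
    (Set.subsingleton_singleton.preimage
      TwoStep.measurableEmbedding_first.injective).measure_zero,
    (Set.subsingleton_singleton.preimage
      TwoStep.measurableEmbedding_second.injective).measure_zero,
    (Set.subsingleton_singleton.preimage
      TwoStep.measurableEmbedding_both.injective).measure_zero]
  simp

theorem TwoStep.integrable_iff {f : TwoStep d → ℝ} :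
    Integrable f ↔ Integrable (fun x => f (.first x)) ∧ Integrable (fun x => f (.second x)) ∧
      Integrable (fun x => f (.both x)) := by
  rw [TwoStep.volume_eq, integrable_add_measure, integrable_add_measure,
    TwoStep.measurableEmbedding_first.integrable_map_iff,
    TwoStep.measurableEmbedding_second.integrable_map_iff,
    TwoStep.measurableEmbedding_both.integrable_map_iff, and_assoc]
  rfl

theorem TwoStep.integral_eq {f : TwoStep d → ℝ} (hf : Integrable f) :
    ∫ X, f X = (∫ x, f (.first x)) + (∫ x, f (.second x)) + ∫ x, f (.both x) := by
  have hf' := hf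
  rw [TwoStep.volume_eq, integrable_add_measure, integrable_add_measure] at hf'
  rw [TwoStep.volume_eq, integral_add_measure (hf'.1.1.add_measure hf'.1.2) hf'.2,
    integral_add_measure hf'.1.1 hf'.1.2,
    TwoStep.measurableEmbedding_first.integral_map,
    TwoStep.measurableEmbedding_second.integral_map,
    TwoStep.measurableEmbedding_both.integral_map]

/-- Coordinates of a trajectory, as a point of a countably separated space. -/
def TwoStep.code : TwoStep d → ℕ × (Fin d → ℝ) × (Fin 2 × Fin d → ℝ)
  | .first x => (0, x, 0)
  | .second x => (1, x, 0)
  | .both x => (2, 0, x)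

theorem TwoStep.measurable_code : Measurable (TwoStep.code (d := d)) := by
  refine TwoStep.measurable_iff.2 ⟨?_, ?_, ?_⟩ <;> simp only [TwoStep.code] <;> fun_prop

theorem TwoStep.code_injective : Function.Injective (TwoStep.code (d := d)) := by
  rintro (x | x | x) (y | y | y) h <;> simp_all [TwoStep.code]

/-- `TwoStep.code` is measurable and injective, so equality can be tested on codes, where equality
sets are known to be measurable. This feeds the Fubini argument in `TwoStep.ae_injective`. -/
theorem TwoStep.measurableSet_eq {β : Type*} [MeasurableSpace β] {f g : β → TwoStep d}
    (hf : Measurable f) (hg : Measurable g) : MeasurableSet {b | f b = g b} := by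
  have h : {b | f b = g b} = {b | (f b).code = (g b).code} := by
    ext b
    exact TwoStep.code_injective.eq_iff.symm
  rw [h]
  exact measurableSet_eq_fun (TwoStep.measurable_code.comp hf) (TwoStep.measurable_code.comp hg)

/-- Set integrals evaluate a density at the image of a tuple, which loses points when entries
coincide. Coincidences are null by Fubini, since singletons are null. -/
theorem TwoStep.ae_injective (hd : 0 < d) (n : ℕ) :
    ∀ᵐ X : Fin n → TwoStep d, Function.Injective X := by
  have := TwoStep.nullSingletonClass hd
  have key : ∀ i j : Fin n, i ≠ j → ∀ᵐ X : Fin n → TwoStep d, X i ≠ X j := by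
    intro i j hij
    obtain _ | n := n
    · exact i.elim0
    -- Coordinate `i` is split off as a first factor; the other index is then coordinate `k` of the
    -- remaining tuple.
    obtain ⟨k, rfl⟩ := Fin.exists_succAbove_eq hij.symm
    have hmp := volume_preserving_piFinSuccAbove (fun _ : Fin (n + 1) => TwoStep d) i
    have h2 : ∀ᵐ p : TwoStep d × (Fin n → TwoStep d), p.1 ≠ p.2 k := by
      rw [Measure.volume_eq_prod]
      refine (Measure.ae_prod_iff_ae_ae ?_).2 ?_
      · exact (TwoStep.measurableSet_eq measurable_fst (by fun_prop)).compl
      · refine Filter.Eventually.of_forall fun x => ?_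
        have h3 : ∀ᵐ y : TwoStep d, x ≠ y := by
          simp [ae_iff]
        exact (Measure.quasiMeasurePreserving_eval (fun _ : Fin n => (volume : Measure (TwoStep d))) k).ae h3
    exact hmp.quasiMeasurePreserving.ae h2
  have h := ae_all_iff.2 fun i => ae_all_iff.2 fun j => ae_all_iff.2 fun hij : i ≠ j => key i j hij
  filter_upwards [h] with X hX i j hij
  by_contra hne
  exact hX i j hne hij

end TwoStepMeasure

/-! ### Generating elements: set convolutions as products of square-zero elements. -/

section GeneratingElements

open scoped Classical

variable {α R : Type} [CommRing R] [Algebra ℝ R]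

/-- The generating element `∑_{T ⊆ X} F(T) ∏_{x ∈ T} e x` of a set function `F`. -/
def gen (e : α → R) (X : Finset α) (F : Finset α → ℝ) : R :=
  ∑ T ∈ X.powerset, F T • ∏ x ∈ T, e x

omit [Algebra ℝ R] in
theorem prod_mul_prod_of_not_disjoint {e : α → R} (he : ∀ x, e x * e x = 0) {A B : Finset α}
    (h : ¬ Disjoint A B) : (∏ x ∈ A, e x) * ∏ x ∈ B, e x = 0 := by
  obtain ⟨x, hA, hB⟩ := Finset.not_disjoint_iff.1 h
  exact zero_dvd_iff.1 (he x ▸ mul_dvd_mul (Finset.dvd_prod_of_mem e hA)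
    (Finset.dvd_prod_of_mem e hB))

/-- In the expanded product, a pair of overlapping subsets contains some `e x * e x` and vanishes;
the disjoint pairs, grouped by their union, give the convolution. -/
theorem gen_mul_gen {e : α → R} (he : ∀ x, e x * e x = 0) (X : Finset α)
    (F G : Finset α → ℝ) : gen e X F * gen e X G = gen e X (conv F G) := by
  unfold gen conv
  rw [Finset.sum_mul_sum, ← Finset.sum_product']
  simp_rw [Finset.sum_smul]
  rw [Finset.sum_sigma']
  symm
  -- A subset `Y` of `T` corresponds to the disjoint pair `(Y, T \ Y)`; the pairs outside the image
  -- of this map are the overlapping ones.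
  refine Finset.sum_of_injOn (fun p => (p.2, p.1 \ p.2)) ?_ ?_ ?_ ?_
  · rintro ⟨T, Y⟩ h ⟨T', Y'⟩ h' heq
    simp only [Finset.coe_sigma, Set.mem_sigma_iff, Finset.mem_coe, Finset.mem_powerset] at h h'
    simp only [Prod.mk.injEq] at heq
    obtain ⟨rfl, h2⟩ := heq
    have : T = T' := by
      rw [← Finset.union_sdiff_of_subset h.2, h2, Finset.union_sdiff_of_subset h'.2]
    subst this
    rfl
  · rintro ⟨T, Y⟩ h
    simp only [Finset.coe_sigma, Set.mem_sigma_iff, Finset.mem_coe, Finset.mem_powerset] at h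
    simp only [Finset.coe_product, Set.mem_prod, Finset.mem_coe, Finset.mem_powerset]
    exact ⟨h.2.trans h.1, Finset.sdiff_subset.trans h.1⟩
  · rintro ⟨A, B⟩ h hn
    simp only [Finset.mem_product, Finset.mem_powerset] at h
    rw [smul_mul_smul_comm, prod_mul_prod_of_not_disjoint he, smul_zero]
    intro hd
    refine hn ⟨⟨A ∪ B, A⟩, ?_, ?_⟩
    · simpa using h
    · simp [Finset.union_sdiff_cancel_left hd]
  · rintro ⟨T, Y⟩ h
    simp only [Finset.mem_sigma, Finset.mem_powerset] at h
    rw [smul_mul_smul_comm, mul_comm (∏ x ∈ Y, e x), Finset.prod_sdiff h.2]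

theorem mem_fiber_map {ι : Type} {W : Finset α} (θ : W → ι) (i : ι) (x : α) :
    x ∈ (Finset.univ.filter fun s => θ s = i).map (Function.Embedding.subtype _) ↔
      ∃ h : x ∈ W, θ ⟨x, h⟩ = i := by
  simp

/-- The version of `gen_mul_gen` for a finite family. A disjoint family is the family of fibres of a
labelling `θ` of its union, and any family with two overlapping members contributes zero. -/
theorem prod_gen {ι : Type} [Fintype ι] {e : α → R} (he : ∀ x, e x * e x = 0) (X : Finset α)
    (F : ι → Finset α → ℝ) : ∏ i, gen e X (F i) = gen e X (familyConv F) := by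
  unfold gen familyConv
  rw [Finset.prod_univ_sum]
  simp_rw [Finset.sum_smul]
  rw [Finset.sum_sigma']
  symm
  refine Finset.sum_of_injOn (fun p i => (Finset.univ.filter fun s => p.2 s = i).map
    (Function.Embedding.subtype _)) ?_ ?_ ?_ ?_
  · rintro ⟨W, θ⟩ h ⟨W', θ'⟩ h' heq
    have hx : ∀ x i, (∃ h : x ∈ W, θ ⟨x, h⟩ = i) ↔ ∃ h : x ∈ W', θ' ⟨x, h⟩ = i := by
      intro x i
      rw [← mem_fiber_map, ← mem_fiber_map]
      exact iff_of_eq (congrArg (fun S : Finset α => x ∈ S) (congrFun heq i))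
    have hW : W = W' := by
      ext x
      constructor
      · intro hxW
        exact ((hx x _).1 ⟨hxW, rfl⟩).1
      · intro hxW
        exact ((hx x _).2 ⟨hxW, rfl⟩).1
    subst hW
    have : θ = θ' := by
      funext x
      obtain ⟨_, h2⟩ := (hx x _).1 ⟨x.2, rfl⟩
      exact h2.symm
    subst this
    rfl
  · rintro ⟨W, θ⟩ h
    simp only [Finset.coe_sigma, Set.mem_sigma_iff, Finset.mem_coe, Finset.mem_powerset] at h
    rw [Finset.mem_coe, Fintype.mem_piFinset]
    intro i
    rw [Finset.mem_powerset]
    intro x hx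
    exact h.1 ((mem_fiber_map θ i x).1 hx).1
  · intro T hT hn
    rw [Fintype.mem_piFinset] at hT
    simp only [Finset.mem_powerset] at hT
    by_cases hd : ∀ i j, i ≠ j → Disjoint (T i) (T j)
    · exfalso
      refine hn ?_
      -- Conversely, a pairwise disjoint family determines its labelling: each point of the union is
      -- sent to an index whose set contains it.
      have hex : ∀ s : (Finset.univ.biUnion T : Finset α), ∃ i, (s : α) ∈ T i := by
        rintro ⟨s, hs⟩
        simpa using hs
      choose θ hθ using hex
      refine ⟨⟨Finset.univ.biUnion T, θ⟩, ?_, ?_⟩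
      · simpa [Finset.biUnion_subset] using hT
      · funext i
        ext x
        rw [mem_fiber_map]
        constructor
        · rintro ⟨h1, h2⟩
          have := hθ ⟨x, h1⟩
          exact (show θ ⟨x, h1⟩ = i from h2) ▸ this
        · intro hx
          have h1 : x ∈ Finset.univ.biUnion T := Finset.mem_biUnion.2 ⟨i, Finset.mem_univ _, hx⟩
          refine ⟨h1, ?_⟩
          by_contra hne
          exact Finset.disjoint_left.1 (hd _ _ hne) (hθ ⟨x, h1⟩) hx
    · push Not at hd
      obtain ⟨i, j, hij, hnd⟩ := hd
      have h1 := Finset.prod_dvd_prod_of_subset {i, j} Finset.univ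
        (fun i => F i (T i) • ∏ x ∈ T i, e x) (Finset.subset_univ _)
      rw [Finset.prod_pair hij, smul_mul_smul_comm, prod_mul_prod_of_not_disjoint he hnd,
        smul_zero] at h1
      exact zero_dvd_iff.1 h1
  · rintro ⟨W, θ⟩ h
    rw [Finset.prod_smul]
    congr 1
    simp only [Finset.prod_map, Function.Embedding.coe_subtype]
    rw [← Finset.prod_coe_sort W e]
    exact (Finset.prod_fiberwise _ θ _).symm

theorem gen_sum_mul {ι : Type} (e : α → R) (X : Finset α) (A : Finset ι) (w : ι → ℝ)
    (F : ι → Finset α → ℝ) :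
    gen e X (fun T => ∑ a ∈ A, w a * F a T) = ∑ a ∈ A, w a • gen e X (F a) := by
  unfold gen
  simp_rw [Finset.sum_smul, Finset.smul_sum, smul_smul]
  exact Finset.sum_comm

theorem gen_pppDensity [MeasureSpace α] (e : α → R) (X : Finset α) (lam : α → ℝ) :
    gen e X (pppDensity lam) = Real.exp (-∫ x, lam x) • ∏ x ∈ X, (1 + lam x • e x) := by
  unfold gen pppDensity
  rw [Finset.prod_one_add, Finset.smul_sum]
  simp_rw [Finset.prod_smul, smul_smul]

theorem gen_bernoulliDensity (e : α → R) (X : Finset α) (r : ℝ) (p : α → ℝ) :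
    gen e X (bernoulliDensity r p) = (1 - r) • 1 + ∑ x ∈ X, (r * p x) • e x := by
  unfold gen
  have h : ∀ T : Finset α, bernoulliDensity r p T • ∏ x ∈ T, e x =
      (if T = ∅ then (1 - r) • (1 : R) else 0) +
        if T.card = 1 then (r * ∏ x ∈ T, p x) • ∏ x ∈ T, e x else 0 := by
    intro T
    unfold bernoulliDensity
    by_cases h0 : T = ∅
    · simp [h0]
    · by_cases h1 : T.card = 1 <;> simp [h0, h1]
  simp_rw [h]
  rw [Finset.sum_add_distrib, Finset.sum_ite_eq' , if_pos (Finset.empty_mem_powerset X),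
    ← Finset.sum_filter, ← Finset.powersetCard_eq_filter, Finset.powersetCard_one]
  simp

end GeneratingElements

/-! ### The universal square-zero algebra and its top coefficient. -/

section SquareZero

open scoped Classical

variable (α S : Type) [CommRing S]

/-- Polynomials modulo the squares of the variables. -/
abbrev SqZero : Type :=
  MvPolynomial α S ⧸ (Ideal.span (Set.range fun x => (MvPolynomial.X x ^ 2 : MvPolynomial α S)))

variable {α S}

/-- The class of a variable. -/
def SqZero.var (x : α) : SqZero α S := Ideal.Quotient.mk _ (MvPolynomial.X x)

theorem SqZero.var_mul_self (x : α) : SqZero.var x * SqZero.var x = (0 : SqZero α S) := by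
  rw [SqZero.var, ← map_mul, ← sq]
  exact Ideal.Quotient.eq_zero_iff_mem.2 (Ideal.subset_span ⟨x, rfl⟩)

/-- The monomial `∏_{x ∈ X} x` is squarefree, hence not a multiple of any squared variable.
Therefore its coefficient descends to the quotient. -/
theorem coeff_eq_zero_of_mem_span_sq (X : Finset α) {q : MvPolynomial α S}
    (hq : q ∈ Ideal.span (Set.range fun x => (MvPolynomial.X x ^ 2 : MvPolynomial α S))) :
    q.coeff (Finsupp.indicator X fun _ _ => 1) = 0 := by
  -- The claim is strengthened to all multiples of `q`, so that the induction over the span passes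
  -- through scalar multiplication.
  suffices h : ∀ a, (a * q).coeff (Finsupp.indicator X fun _ _ => 1) = 0 by simpa using h 1
  induction hq using Submodule.span_induction with
  | mem y hy =>
    obtain ⟨x, rfl⟩ := hy
    intro a
    simp only [MvPolynomial.X_pow_eq_monomial, MvPolynomial.coeff_mul_monomial']
    rw [if_neg]
    intro h
    have := h x
    rw [Finsupp.single_eq_same, Finsupp.indicator_apply] at this
    split_ifs at this
    all_goals omega
  | zero => simp
  | add y z _ _ hy hz =>
    intro a
    rw [mul_add, MvPolynomial.coeff_add, hy, hz, add_zero]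
  | smul b y _ hy =>
    intro a
    rw [smul_eq_mul, ← mul_assoc]
    exact hy _

/-- The coefficient of `∏_{x ∈ X} x`. -/
def SqZero.coeff (X : Finset α) : SqZero α S →ₗ[S] S :=
  (Submodule.liftQ ((Ideal.span (Set.range fun x =>
      (MvPolynomial.X x ^ 2 : MvPolynomial α S))).restrictScalars S)
    (MvPolynomial.lcoeff S (Finsupp.indicator X fun _ _ => 1))
    (fun _ hq => coeff_eq_zero_of_mem_span_sq X hq)).comp
    (Submodule.Quotient.restrictScalarsEquiv S _).symm.toLinearMap

theorem SqZero.coeff_mk (X : Finset α) (q : MvPolynomial α S) :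
    SqZero.coeff X (Ideal.Quotient.mk _ q) = q.coeff (Finsupp.indicator X fun _ _ => 1) := rfl

/-- Exponents other than zero and one are needed too: later `c` counts how many targets use a given
measurement. -/
theorem SqZero.coeff_prod_var_pow (X : Finset α) (c : α → ℕ) :
    SqZero.coeff X (∏ x ∈ X, SqZero.var x ^ c x) = if ∀ x ∈ X, c x = 1 then (1 : S) else 0 := by
  have h : ∏ x ∈ X, SqZero.var x ^ c x = (Ideal.Quotient.mk _
      (MvPolynomial.monomial (Finsupp.indicator X fun x _ => c x) 1) : SqZero α S) := by
    rw [MvPolynomial.monomial_eq, Finsupp.prod_of_support_subset _ (s := X)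
      (Finsupp.support_indicator_subset _ _) _ (by simp), map_one, one_mul, map_prod]
    refine Finset.prod_congr rfl fun x hx => ?_
    rw [map_pow, Finsupp.indicator_of_mem hx, SqZero.var]
  rw [h, SqZero.coeff_mk, MvPolynomial.coeff_monomial]
  refine if_congr ?_ rfl rfl
  constructor
  · intro heq x hx
    have := DFunLike.congr_fun heq x
    rwa [Finsupp.indicator_of_mem hx, Finsupp.indicator_of_mem hx] at this
  · intro hc
    ext x
    by_cases hx : x ∈ X
    · rw [Finsupp.indicator_of_mem hx, Finsupp.indicator_of_mem hx, hc x hx]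
    · rw [Finsupp.indicator_of_notMem hx, Finsupp.indicator_of_notMem hx]

theorem SqZero.coeff_prod_var {X T : Finset α} (hT : T ⊆ X) :
    SqZero.coeff X (∏ x ∈ T, SqZero.var x) = if T = X then (1 : S) else 0 := by
  have h : ∏ x ∈ T, (SqZero.var x : SqZero α S) =
      ∏ x ∈ X, SqZero.var x ^ (if x ∈ T then 1 else 0) := by
    rw [← Finset.prod_subset hT fun x _ hx => by simp [hx]]
    exact Finset.prod_congr rfl fun x hx => by simp [hx]
  rw [h, SqZero.coeff_prod_var_pow]
  refine if_congr ?_ rfl rfl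
  constructor
  · intro hc
    exact hT.antisymm fun x hx => by simpa using hc x hx
  · rintro rfl x hx
    simp [hx]

/-- Rescaling the variables by `c` multiplies the top coefficient by `∏ c`. -/
theorem SqZero.coeff_gen_smul [Algebra ℝ S] (X : Finset α) (c : α → S) (F : Finset α → ℝ) :
    SqZero.coeff X (gen (fun x => c x • (SqZero.var x : SqZero α S)) X F) =
      F X • ∏ x ∈ X, c x := by
  unfold gen
  have h : ∀ T ∈ X.powerset,
      SqZero.coeff X (F T • ∏ x ∈ T, c x • (SqZero.var x : SqZero α S)) =
        if T = X then F X • ∏ x ∈ X, c x else 0 := by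
    intro T hT
    rw [Finset.prod_smul, ← algebraMap_smul S (F T), map_smul, map_smul,
      SqZero.coeff_prod_var (Finset.mem_powerset.1 hT)]
    split_ifs with hTX
    · rw [hTX, algebraMap_smul, smul_eq_mul, mul_one]
    · rw [smul_zero, smul_zero]
  rw [map_sum, Finset.sum_congr rfl h, Finset.sum_ite_eq', if_pos (Finset.mem_powerset_self X)]

theorem SqZero.coeff_gen [Algebra ℝ S] (X : Finset α) (F : Finset α → ℝ) :
    SqZero.coeff X (gen (fun x => (SqZero.var x : SqZero α S)) X F) = algebraMap ℝ S (F X) := by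
  have h := SqZero.coeff_gen_smul (S := S) X (fun _ => 1) F
  simpa [Algebra.algebraMap_eq_smul_one] using h

/-- Taking top coefficients transfers identities between generating elements back to set functions.
-/
theorem gen_injective {X : Finset α} {F G : Finset α → ℝ}
    (h : gen (fun x => (SqZero.var x : SqZero α ℝ)) X F = gen SqZero.var X G) : F X = G X := by
  simpa [SqZero.coeff_gen] using congrArg (SqZero.coeff X) h

end SquareZero

/-! ### Set integrals of Poisson multi-Bernoulli densities. -/

section SetIntegrals

open scoped Classical

theorem conv_bernoulliDensity {α : Type} (F : Finset α → ℝ) (r : ℝ) (p : α → ℝ) (S : Finset α) :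
    conv F (bernoulliDensity r p) S = (1 - r) * F S + r * ∑ x ∈ S, p x * F (S.erase x) := by
  unfold conv
  -- The sum is reindexed by complements, so that it runs over the argument of the Bernoulli
  -- density, of which only the empty set and singletons count.
  have h1 : ∑ Y ∈ S.powerset, F Y * bernoulliDensity r p (S \ Y) =
      ∑ T ∈ S.powerset, F (S \ T) * bernoulliDensity r p T := by
    refine Finset.sum_nbij' (S \ ·) (S \ ·) ?_ ?_ ?_ ?_ ?_ <;> intro Y hY <;>
      simp only [Finset.mem_powerset] at hY <;> simp [hY]
  have h2 : ∀ T : Finset α, F (S \ T) * bernoulliDensity r p T =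
      (if T = ∅ then (1 - r) * F S else 0) +
        if T.card = 1 then r * ((∏ x ∈ T, p x) * F (S \ T)) else 0 := by
    intro T
    unfold bernoulliDensity
    by_cases h0 : T = ∅
    · simp [h0, mul_comm]
    · by_cases h1 : T.card = 1
      · simp only [h0, h1, if_false, if_true]
        ring
      · simp [h0, h1]
  rw [h1]
  simp_rw [h2]
  rw [Finset.sum_add_distrib, Finset.sum_ite_eq' , if_pos (Finset.empty_mem_powerset S),
    ← Finset.sum_filter, ← Finset.powersetCard_eq_filter, Finset.powersetCard_one, Finset.mul_sum]
  simp [Finset.sdiff_singleton_eq_erase]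

variable {d : ℕ}

/-- All terms of the set integral of `D` are integrals of integrable functions, and the series
converges to `1`. -/
def HasUnitSetIntegral (D : Finset (TwoStep d) → ℝ) : Prop :=
  (∀ n, Integrable fun X : Fin n → TwoStep d => D (Finset.univ.image X)) ∧
    HasSum (fun n : ℕ => ((n.factorial : ℝ))⁻¹ *
      ∫ X : Fin n → TwoStep d, D (Finset.univ.image X)) 1

/-- Almost every tuple has distinct entries, so the `n`-th term is `e^{-Λ} Λ^n / n!` with `Λ = ∫
lam`, and the exponential series sums to one. -/
theorem hasUnitSetIntegral_pppDensity (hd : 0 < d) {lam : TwoStep d → ℝ} (hlam : Integrable lam) :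
    HasUnitSetIntegral (pppDensity lam) := by
  have hae : ∀ n, (fun X : Fin n → TwoStep d => pppDensity lam (Finset.univ.image X)) =ᵐ[volume]
      fun X => Real.exp (-∫ x, lam x) * ∏ i, lam (X i) := by
    intro n
    filter_upwards [TwoStep.ae_injective hd n] with X hX
    rw [pppDensity, Finset.prod_image hX.injOn]
  refine ⟨fun n => ?_, ?_⟩
  · exact ((Integrable.fintype_prod (f := fun _ : Fin n => lam) fun _ => hlam).const_mul _).congr
      (hae n).symm
  · have h : ∀ n : ℕ, ((n.factorial : ℝ))⁻¹ *
        ∫ X : Fin n → TwoStep d, pppDensity lam (Finset.univ.image X) =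
        Real.exp (-∫ x, lam x) * ((∫ x, lam x) ^ n / n.factorial) := by
      intro n
      rw [integral_congr_ae (hae n), integral_const_mul, integral_fintype_prod_volume_eq_pow,
        Fintype.card_fin]
      ring
    simp_rw [h]
    have := (NormedSpace.expSeries_div_hasSum_exp (∫ x, lam x)).mul_left (Real.exp (-∫ x, lam x))
    rwa [← Real.exp_eq_exp_ℝ, ← Real.exp_add, neg_add_cancel, Real.exp_zero] at this

theorem sum_image_erase {n : ℕ} {X : Fin (n + 1) → TwoStep d} (hX : Function.Injective X)
    (p : TwoStep d → ℝ) (D : Finset (TwoStep d) → ℝ) :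
    ∑ x ∈ Finset.univ.image X, p x * D ((Finset.univ.image X).erase x) =
      ∑ k, p (X k) * D (Finset.univ.image fun i => X (k.succAbove i)) := by
  rw [Finset.sum_image hX.injOn]
  refine Finset.sum_congr rfl fun k _ => ?_
  congr 2
  ext y
  simp only [Finset.mem_erase, Finset.mem_image, Finset.mem_univ, true_and]
  constructor
  · rintro ⟨hne, i, rfl⟩
    obtain ⟨j, rfl⟩ := Fin.exists_succAbove_eq (fun h : i = k => hne (h ▸ rfl))
    exact ⟨j, rfl⟩
  · rintro ⟨j, rfl⟩
    exact ⟨fun h => Fin.succAbove_ne k j (hX h), _, rfl⟩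

theorem integrable_mul_succAbove {n : ℕ} {p : TwoStep d → ℝ} (hp : Integrable p)
    {g : (Fin n → TwoStep d) → ℝ} (hg : Integrable g) (k : Fin (n + 1)) :
    Integrable fun X : Fin (n + 1) → TwoStep d => p (X k) * g fun i => X (k.succAbove i) := by
  have hmp := volume_preserving_piFinSuccAbove (fun _ : Fin (n + 1) => TwoStep d) k
  exact hmp.integrable_comp_of_integrable (hp.mul_prod hg)

theorem integral_mul_succAbove {n : ℕ} (p : TwoStep d → ℝ) (g : (Fin n → TwoStep d) → ℝ)
    (k : Fin (n + 1)) :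
    ∫ X : Fin (n + 1) → TwoStep d, p (X k) * g (fun i => X (k.succAbove i)) =
      (∫ x, p x) * ∫ Y, g Y := by
  have hmp := volume_preserving_piFinSuccAbove (fun _ : Fin (n + 1) => TwoStep d) k
  have h := hmp.integral_comp' fun q : TwoStep d × (Fin n → TwoStep d) => p q.1 * g q.2
  rw [Measure.volume_eq_prod, integral_prod_mul] at h
  exact h

/-- If `I n` are the terms for `D`, the new terms are `(1 - r) I (n+1) + r I n`: the Bernoulli point
can be any of the `n + 1` entries, and this factor cancels against the factorial. The sum is `(1 -
r) + r = 1`. -/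
theorem HasUnitSetIntegral.conv_bernoulliDensity (hd : 0 < d) {D : Finset (TwoStep d) → ℝ}
    (hD : HasUnitSetIntegral D) {r : ℝ} {p : TwoStep d → ℝ} (hp : Integrable p)
    (hp1 : ∫ x, p x = 1) : HasUnitSetIntegral (conv D (bernoulliDensity r p)) := by
  obtain ⟨hint, hsum⟩ := hD
  have hae : ∀ n, (fun X : Fin (n + 1) → TwoStep d =>
      conv D (bernoulliDensity r p) (Finset.univ.image X)) =ᵐ[volume]
      fun X => (1 - r) * D (Finset.univ.image X) +
        r * ∑ k, p (X k) * D (Finset.univ.image fun i => X (k.succAbove i)) := by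
    intro n
    filter_upwards [TwoStep.ae_injective hd (n + 1)] with X hX
    rw [TMPMBM.conv_bernoulliDensity, sum_image_erase hX]
  have h0 : (fun X : Fin 0 → TwoStep d =>
      conv D (bernoulliDensity r p) (Finset.univ.image X)) =
      fun X => (1 - r) * D (Finset.univ.image X) := by
    funext X
    rw [TMPMBM.conv_bernoulliDensity]
    simp
  have hterm : ∀ n (k : Fin (n + 1)), Integrable fun X : Fin (n + 1) → TwoStep d =>
      p (X k) * D (Finset.univ.image fun i => X (k.succAbove i)) := fun n k =>
    integrable_mul_succAbove hp (hint n) k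
  constructor
  · rintro (_ | n)
    · rw [h0]
      exact (hint 0).const_mul _
    · exact (((hint (n + 1)).const_mul _).add
        ((integrable_finsetSum _ fun k _ => hterm n k).const_mul _)).congr (hae n).symm
  · set I : ℕ → ℝ := fun n => ((n.factorial : ℝ))⁻¹ *
      ∫ X : Fin n → TwoStep d, D (Finset.univ.image X) with hI
    have hS : ∀ n : ℕ, (((n + 1).factorial : ℝ))⁻¹ * ∫ X : Fin (n + 1) → TwoStep d,
        conv D (bernoulliDensity r p) (Finset.univ.image X) = (1 - r) * I (n + 1) + r * I n := by
      intro n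
      have hk : ∀ k : Fin (n + 1), ∫ X : Fin (n + 1) → TwoStep d,
          p (X k) * D (Finset.univ.image fun i => X (k.succAbove i)) =
          ∫ X : Fin n → TwoStep d, D (Finset.univ.image X) := by
        intro k
        rw [integral_mul_succAbove p (fun Y : Fin n → TwoStep d => D (Finset.univ.image Y)) k,
          hp1, one_mul]
      rw [integral_congr_ae (hae n), integral_add ((hint (n + 1)).const_mul _)
        ((integrable_finsetSum _ fun k _ => hterm n k).const_mul _), integral_const_mul,
        integral_const_mul, integral_finsetSum _ fun k _ => hterm n k,
        Finset.sum_congr rfl fun k _ => hk k, Finset.sum_const, Finset.card_univ,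
        Fintype.card_fin, nsmul_eq_mul, hI]
      simp only [Nat.factorial_succ, Nat.cast_mul]
      have h1 : ((n + 1 : ℕ) : ℝ) ≠ 0 := Nat.cast_ne_zero.2 n.succ_ne_zero
      have h2 : (n.factorial : ℝ) ≠ 0 := Nat.cast_ne_zero.2 n.factorial_ne_zero
      field_simp
    have hZ : (((0 : ℕ).factorial : ℝ))⁻¹ * ∫ X : Fin 0 → TwoStep d,
        conv D (bernoulliDensity r p) (Finset.univ.image X) = (1 - r) * I 0 := by
      rw [h0, integral_const_mul, hI]
      ring
    -- The term of cardinality zero is treated separately, since there the Bernoulli process can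
    -- only be empty.
    rw [← hasSum_nat_add_iff' 1]
    simp_rw [hS]
    rw [Finset.sum_range_one, hZ]
    have h1 := ((hasSum_nat_add_iff' 1).2 hsum).mul_left (1 - r)
    rw [Finset.sum_range_one] at h1
    have hv : 1 - (1 - r) * I 0 = (1 - r) * (1 - I 0) + r * 1 := by ring
    rw [hv]
    exact h1.add (hsum.mul_left r)

/-- A Poisson multi-Bernoulli density integrates to one. -/
theorem hasUnitSetIntegral_pmb (hd : 0 < d) {lam : TwoStep d → ℝ} (hlam : Integrable lam)
    {ι : Type} [Fintype ι] (r : ι → ℝ) (p : ι → TwoStep d → ℝ)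
    (hp : ∀ i, r i ≠ 0 → ∫ x, p i x = 1) :
    HasUnitSetIntegral
      (conv (pppDensity lam) (familyConv fun i => bernoulliDensity (r i) (p i))) := by
  -- The targets are convolved in one at a time. Only the generating element of the resulting `D` is
  -- tracked; `gen_injective` identifies `D` at the end.
  have key : ∀ s : Finset ι, ∃ D, HasUnitSetIntegral D ∧ ∀ X,
      gen (fun x => (SqZero.var x : SqZero (TwoStep d) ℝ)) X D =
        gen SqZero.var X (pppDensity lam) *
          ∏ i ∈ s, gen SqZero.var X (bernoulliDensity (r i) (p i)) := by
    intro s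
    induction s using Finset.induction_on with
    | empty => exact ⟨_, hasUnitSetIntegral_pppDensity hd hlam, fun X => by simp⟩
    | insert i s hi ih =>
      obtain ⟨D, hD, hgen⟩ := ih
      -- With zero probability of existence nothing is assumed about `p i`, but the factor is then
      -- `1` and `D` can be kept.
      by_cases hr : r i = 0
      · refine ⟨D, hD, fun X => ?_⟩
        rw [Finset.prod_insert hi, gen_bernoulliDensity, hr, hgen]
        simp
      · refine ⟨conv D (bernoulliDensity (r i) (p i)), hD.conv_bernoulliDensity hd ?_ (hp i hr),
          fun X => ?_⟩
        · by_contra hc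
          have := hp i hr
          rw [integral_undef hc] at this
          exact zero_ne_one this
        · rw [← gen_mul_gen SqZero.var_mul_self, hgen, Finset.prod_insert hi]
          ring
  obtain ⟨D, hD, hgen⟩ := key Finset.univ
  convert hD using 1
  funext X
  refine gen_injective ?_
  rw [hgen, prod_gen SqZero.var_mul_self, ← gen_mul_gen SqZero.var_mul_self]

/-- Terms of zero weight are exempt because hypotheses of zero weight may carry functions that are
not normalised. -/
theorem setIntegral_sum_mul {ι : Type} (A : Finset ι) (w : ι → ℝ)
    (D : ι → Finset (TwoStep d) → ℝ) (hD : ∀ a ∈ A, w a ≠ 0 → HasUnitSetIntegral (D a)) :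
    setIntegral (fun X => ∑ a ∈ A, w a * D a X) = ∑ a ∈ A, w a := by
  have hint : ∀ n, ∀ a ∈ A, Integrable fun X : Fin n → TwoStep d =>
      w a * D a (Finset.univ.image X) := by
    intro n a ha
    by_cases hw : w a = 0
    · simp [hw]
    · exact ((hD a ha hw).1 n).const_mul _
  have hs : ∀ a ∈ A, HasSum (fun n : ℕ => ((n.factorial : ℝ))⁻¹ *
      ∫ X : Fin n → TwoStep d, w a * D a (Finset.univ.image X)) (w a) := by
    intro a ha
    by_cases hw : w a = 0
    · simp [hw]
    · have := (hD a ha hw).2.mul_left (w a)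
      simp_rw [integral_const_mul]
      rw [mul_one] at this
      refine this.congr_fun fun n => ?_
      rw [mul_left_comm]
  unfold setIntegral
  have := hasSum_sum hs
  rw [← this.tsum_eq]
  congr 1
  funext n
  rw [integral_finsetSum _ (hint n), Finset.mul_sum]

end SetIntegrals

/-! ### Gaussians supported on one piece of the trajectory space. -/

section TrajectoryGaussians

variable {d : ℕ}

theorem gaussFirst_nonneg (μ : Fin d → ℝ) (P : Matrix (Fin d) (Fin d) ℝ) (X : TwoStep d) :
    0 ≤ gaussFirst μ P X := by
  cases X <;> simp [gaussFirst, gauss_nonneg]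

theorem gaussSecond_nonneg (μ : Fin d → ℝ) (P : Matrix (Fin d) (Fin d) ℝ) (X : TwoStep d) :
    0 ≤ gaussSecond μ P X := by
  cases X <;> simp [gaussSecond, gauss_nonneg]

theorem gaussBoth_nonneg (μ : Fin 2 × Fin d → ℝ) (P : Matrix (Fin 2 × Fin d) (Fin 2 × Fin d) ℝ)
    (X : TwoStep d) : 0 ≤ gaussBoth μ P X := by
  cases X <;> simp [gaussBoth, gauss_nonneg]

theorem integrable_gaussFirst (μ : Fin d → ℝ) {P : Matrix (Fin d) (Fin d) ℝ} (hP : P.PosDef) :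
    Integrable (gaussFirst μ P) :=
  TwoStep.integrable_iff.2 ⟨integrable_gauss hP μ, integrable_zero _ _ _, integrable_zero _ _ _⟩

theorem integrable_gaussSecond (μ : Fin d → ℝ) {P : Matrix (Fin d) (Fin d) ℝ} (hP : P.PosDef) :
    Integrable (gaussSecond μ P) :=
  TwoStep.integrable_iff.2 ⟨integrable_zero _ _ _, integrable_gauss hP μ, integrable_zero _ _ _⟩

theorem integrable_gaussBoth (μ : Fin 2 × Fin d → ℝ)
    {P : Matrix (Fin 2 × Fin d) (Fin 2 × Fin d) ℝ} (hP : P.PosDef) :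
    Integrable (gaussBoth μ P) :=
  TwoStep.integrable_iff.2 ⟨integrable_zero _ _ _, integrable_zero _ _ _, integrable_gauss hP μ⟩

theorem integral_gaussFirst (μ : Fin d → ℝ) {P : Matrix (Fin d) (Fin d) ℝ} (hP : P.PosDef) :
    ∫ X, gaussFirst μ P X = 1 := by
  rw [TwoStep.integral_eq (integrable_gaussFirst μ hP)]
  simp [gaussFirst, integral_gauss hP]

theorem integral_gaussSecond (μ : Fin d → ℝ) {P : Matrix (Fin d) (Fin d) ℝ} (hP : P.PosDef) :
    ∫ X, gaussSecond μ P X = 1 := by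
  rw [TwoStep.integral_eq (integrable_gaussSecond μ hP)]
  simp [gaussSecond, integral_gauss hP]

theorem integral_gaussBoth (μ : Fin 2 × Fin d → ℝ)
    {P : Matrix (Fin 2 × Fin d) (Fin 2 × Fin d) ℝ} (hP : P.PosDef) :
    ∫ X, gaussBoth μ P X = 1 := by
  rw [TwoStep.integral_eq (integrable_gaussBoth μ hP)]
  simp [gaussBoth, integral_gauss hP]

end TrajectoryGaussians

variable {nx nz n m nb np : ℕ} {h : Fin n → ℕ}

/-! ### Algebra of the measurement matrices. -/

section Model

variable {M : MeasModel nx nz}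

theorem MeasModel.Valid.γ_nonneg (hM : M.Valid) : 0 ≤ M.γ := by
  have := hM.pFull_mem.2
  unfold MeasModel.γ
  linarith

theorem MeasModel.Valid.R2_posDef (hM : M.Valid) : M.R2.PosDef :=
  Matrix.PosDef.one.kronecker hM.R_posDef

theorem MeasModel.H13_apply (M : MeasModel nx nz) (i : Fin nz) (s : Fin 2) (j : Fin nx) :
    M.H13 i (s, j) = if s = 0 then M.H i j else 0 := by
  fin_cases s <;> simp [MeasModel.H13]

/-- `H13` sees only the block at time `k`. Together with `MeasModel.innovCov_H13` this shows that,
under `SameMarginal`, both mixture components predict the same measurement Gaussian, which therefore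
factors out of the detection weight. -/
theorem MeasModel.H13_mulVec (M : MeasModel nx nz) {x : Fin 2 × Fin nx → ℝ} {y : Fin nx → ℝ}
    (hxy : ∀ i, x (0, i) = y i) : M.H13 *ᵥ x = M.H *ᵥ y := by
  ext i
  simp [Matrix.mulVec, dotProduct, Fintype.sum_prod_type, MeasModel.H13_apply, hxy]

theorem MeasModel.innovCov_H13 (M : MeasModel nx nz)
    {P : Matrix (Fin 2 × Fin nx) (Fin 2 × Fin nx) ℝ} {Q : Matrix (Fin nx) (Fin nx) ℝ}
    (hPQ : ∀ i j, P (0, i) (0, j) = Q i j) : innovCov M.H13 M.R P = innovCov M.H M.R Q := by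
  ext i k
  simp [innovCov, Matrix.mul_apply, Fintype.sum_prod_type, MeasModel.H13_apply, hPQ]

end Model

/-! ### Update of one Gaussian Bernoulli component. -/

section Bernoulli

variable {M : MeasModel nx nz} {B : GaussBern nx}

theorem GaussBern.Valid.density_nonneg (hB : B.Valid) (X : TwoStep nx) : 0 ≤ B.density X :=
  add_nonneg (mul_nonneg hB.β1_nonneg (gaussFirst_nonneg _ _ _))
    (mul_nonneg hB.β2_nonneg (gaussBoth_nonneg _ _ _))

theorem GaussBern.Valid.integral_density (hB : B.Valid) : ∫ X, B.density X = 1 := by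
  simp only [GaussBern.density]
  rw [integral_add ((integrable_gaussFirst _ hB.cov1_posDef).const_mul _)
    ((integrable_gaussBoth _ hB.cov2_posDef).const_mul _), integral_const_mul, integral_const_mul,
    integral_gaussFirst _ hB.cov1_posDef, integral_gaussBoth _ hB.cov2_posDef, mul_one, mul_one,
    hB.β_sum]

theorem GaussBern.Valid.innerProd_const (hB : B.Valid) (c : ℝ) :
    innerProd B.density (fun _ => c) = c := by
  rw [innerProd, integral_mul_const, hB.integral_density, one_mul]

theorem mul_le_one_of_mem_Icc {a b : ℝ} (ha : a ∈ Set.Icc (0 : ℝ) 1) (hb : b ∈ Set.Icc (0 : ℝ) 1) :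
    a * b ≤ 1 := mul_le_one₀ ha.2 hb.1 hb.2

theorem GaussBern.Valid.missedWeight_nonneg (hB : B.Valid) (hM : M.Valid) :
    0 ≤ B.missedWeight M :=
  sub_nonneg.2 (mul_le_one_of_mem_Icc hB.r_mem hM.pD_mem)

theorem GaussBern.Valid.missed (hB : B.Valid) (hM : M.Valid) : (B.missed M).Valid where
  r_mem := by
    have h1 := mul_le_one_of_mem_Icc hB.r_mem hM.pD_mem
    refine ⟨div_nonneg (mul_nonneg hB.r_mem.1 (sub_nonneg.2 hM.pD_mem.2)) (sub_nonneg.2 h1),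
      div_le_one_of_le₀ ?_ (sub_nonneg.2 h1)⟩
    have := hB.r_mem.2
    nlinarith
  β1_nonneg := hB.β1_nonneg
  β2_nonneg := hB.β2_nonneg
  β_sum := hB.β_sum
  cov1_posDef := hB.cov1_posDef
  cov2_posDef := hB.cov2_posDef

/-- If a missed detection is impossible, the target exists and is always detected. -/
theorem GaussBern.Valid.eq_one_of_missedWeight_eq_zero (hB : B.Valid) (hM : M.Valid)
    (h0 : B.missedWeight M = 0) : B.r = 1 ∧ M.pD = 1 := by
  obtain ⟨hr0, hr1⟩ := hB.r_mem
  obtain ⟨hp0, hp1⟩ := hM.pD_mem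
  rw [GaussBern.missedWeight] at h0
  constructor <;> nlinarith

/-- With the denominator cleared, the identity survives the degenerate case of zero weight: then `r
= 1`, and both sides vanish whatever value the quotient takes. -/
theorem GaussBern.Valid.missedWeight_mul_one_sub_r (hB : B.Valid) (hM : M.Valid) :
    B.missedWeight M * (1 - (B.missed M).r) = 1 - B.r := by
  by_cases h0 : B.missedWeight M = 0
  · rw [h0, (hB.eq_one_of_missedWeight_eq_zero hM h0).1]
    ring
  · have h1 : (B.missed M).r = B.r * (1 - M.pD) / B.missedWeight M := rfl
    rw [h1, mul_sub, mul_div_cancel₀ _ h0, GaussBern.missedWeight]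
    ring

theorem GaussBern.Valid.missedWeight_mul_r (hB : B.Valid) (hM : M.Valid) :
    B.missedWeight M * (B.missed M).r = B.r * (1 - M.pD) := by
  by_cases h0 : B.missedWeight M = 0
  · rw [h0, (hB.eq_one_of_missedWeight_eq_zero hM h0).2]
    ring
  · have h1 : (B.missed M).r = B.r * (1 - M.pD) / B.missedWeight M := rfl
    rw [h1, mul_div_cancel₀ _ h0]

/-- The probability density of detecting `Z` from an existing target, `⟨p, l(Z|·) p^D⟩`. -/
def GaussBern.detDensity (M : MeasModel nx nz) (B : GaussBern nx) : TwoStep nz → ℝ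
  | .first z => M.pD * (B.β1 + B.β2 * M.γ) *
      gauss z (M.H *ᵥ B.mean1) (innovCov M.H M.R B.cov1)
  | .both z => M.pD * B.β2 * M.pFull *
      gauss z (M.H33 *ᵥ B.mean2) (innovCov M.H33 M.R2 B.cov2)
  | .second z => M.pD * B.β2 * M.γ *
      gauss z (M.H23 *ᵥ B.mean2) (innovCov M.H23 M.R B.cov2)

theorem GaussBern.detWeight_eq (M : MeasModel nx nz) (B : GaussBern nx) (Z : TwoStep nz) :
    B.detWeight M Z = B.r * B.detDensity M Z := by
  cases Z <;> simp only [GaussBern.detWeight, GaussBern.detDensity] <;> ring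

theorem GaussBern.Valid.detDensity_nonneg (hB : B.Valid) (hM : M.Valid) (Z : TwoStep nz) :
    0 ≤ B.detDensity M Z := by
  have h1 := hB.β1_nonneg
  have h2 := hB.β2_nonneg
  have h3 := hM.γ_nonneg
  have h4 := hM.pD_mem.1
  have h5 := hM.pFull_mem.1
  cases Z <;> exact mul_nonneg (by positivity) (gauss_nonneg _ _ _)

/-- Bayes' rule for a single trajectory in multiplied-out form: on each piece of the trajectory
space it is one instance of `gauss_mul_gauss`. -/
theorem GaussBern.Valid.lpD_mul_density (hB : B.Valid) (hM : M.Valid) (hmarg : B.SameMarginal)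
    (Z : TwoStep nz) (X : TwoStep nx) :
    M.lpD Z X * B.density X = B.detDensity M Z * (B.detected M Z).density X := by
  cases Z with
  | first z =>
    have hg1 := fun x => gauss_mul_gauss (H := M.H) hM.R_posDef hB.cov1_posDef x B.mean1 z
    have hg2 := fun x => gauss_mul_gauss (H := M.H13) hM.R_posDef hB.cov2_posDef x B.mean2 z
    -- Here the common marginal enters: the predictive Gaussian of the two-step component becomes
    -- that of the one-step component.
    rw [M.H13_mulVec hmarg.1, M.innovCov_H13 hmarg.2] at hg2
    have hb1 := hB.β1_nonneg
    have hb2 := mul_nonneg hB.β2_nonneg hM.γ_nonneg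
    -- If the normaliser of the mixture weights is zero, nonnegativity makes both summands zero.
    -- Both sides then vanish, although the updated weights are divisions by zero.
    by_cases hβ : B.β1 + B.β2 * M.γ = 0
    · have h1 : B.β1 = 0 := by linarith
      have h2 : B.β2 * M.γ = 0 := by linarith
      have h3 : B.detDensity M (.first z) = 0 := by simp [GaussBern.detDensity, hβ]
      rw [h3, zero_mul]
      cases X with
      | first x => simp [GaussBern.density, gaussBoth, h1]
      | second x => simp [GaussBern.density, gaussFirst, gaussBoth]
      | both x =>
        simp only [MeasModel.lpD, MeasModel.l, GaussBern.density, gaussFirst, gaussBoth, mul_zero,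
          zero_add]
        linear_combination gauss z (M.H13 *ᵥ x) M.R * M.pD * gauss x B.mean2 B.cov2 * h2
    · cases X with
      | first x =>
        simp only [MeasModel.lpD, MeasModel.l, GaussBern.density, gaussFirst, gaussBoth,
          GaussBern.detDensity, GaussBern.detected, mul_zero, add_zero]
        have : (B.β1 + B.β2 * M.γ) * (B.β1 / (B.β1 + B.β2 * M.γ)) = B.β1 := mul_div_cancel₀ _ hβ
        linear_combination M.pD * B.β1 * hg1 x - M.pD *
          (gauss z (M.H *ᵥ B.mean1) (innovCov M.H M.R B.cov1) *
            gauss x (kalmanMean M.H M.R z B.mean1 B.cov1) (kalmanCov M.H M.R B.cov1)) * this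
      | second x =>
        simp [MeasModel.lpD, MeasModel.l, GaussBern.density, gaussFirst, gaussBoth]
      | both x =>
        simp only [MeasModel.lpD, MeasModel.l, GaussBern.density, gaussFirst, gaussBoth,
          GaussBern.detDensity, GaussBern.detected, mul_zero, zero_add]
        have : (B.β1 + B.β2 * M.γ) * (B.β2 * M.γ / (B.β1 + B.β2 * M.γ)) = B.β2 * M.γ :=
          mul_div_cancel₀ _ hβ
        linear_combination M.pD * B.β2 * M.γ * hg2 x - M.pD *
          (gauss z (M.H *ᵥ B.mean1) (innovCov M.H M.R B.cov1) *
            gauss x (kalmanMean M.H13 M.R z B.mean2 B.cov2) (kalmanCov M.H13 M.R B.cov2)) * this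
  | second z =>
    cases X with
    | first x => simp [MeasModel.lpD, MeasModel.l, GaussBern.density, gaussFirst, gaussBoth,
        GaussBern.detected]
    | second x => simp [MeasModel.lpD, MeasModel.l, GaussBern.density, gaussFirst, gaussBoth,
        GaussBern.detected]
    | both x =>
      simp only [MeasModel.lpD, MeasModel.l, GaussBern.density, gaussFirst, gaussBoth,
        GaussBern.detDensity, GaussBern.detected, mul_zero, zero_add]
      linear_combination M.pD * B.β2 * M.γ *
        gauss_mul_gauss (H := M.H23) hM.R_posDef hB.cov2_posDef x B.mean2 z
  | both z =>
    cases X with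
    | first x => simp [MeasModel.lpD, MeasModel.l, GaussBern.density, gaussFirst, gaussBoth,
        GaussBern.detected]
    | second x => simp [MeasModel.lpD, MeasModel.l, GaussBern.density, gaussFirst, gaussBoth,
        GaussBern.detected]
    | both x =>
      simp only [MeasModel.lpD, MeasModel.l, GaussBern.density, gaussFirst, gaussBoth,
        GaussBern.detDensity, GaussBern.detected, mul_zero, zero_add]
      linear_combination M.pD * B.β2 * M.pFull *
        gauss_mul_gauss (H := M.H33) hM.R2_posDef hB.cov2_posDef x B.mean2 z

theorem GaussBern.Valid.detected (hB : B.Valid) (hM : M.Valid) {Z : TwoStep nz}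
    (h0 : B.detDensity M Z ≠ 0) : (B.detected M Z).Valid := by
  have hb1 := hB.β1_nonneg
  have hb2 := mul_nonneg hB.β2_nonneg hM.γ_nonneg
  cases Z with
  | first z =>
    have hβ : B.β1 + B.β2 * M.γ ≠ 0 := fun hc => h0 (by simp [GaussBern.detDensity, hc])
    exact
      { r_mem := ⟨zero_le_one, le_rfl⟩
        β1_nonneg := div_nonneg hb1 (add_nonneg hb1 hb2)
        β2_nonneg := div_nonneg hb2 (add_nonneg hb1 hb2)
        β_sum := by simp only [GaussBern.detected]; rw [← add_div, div_self hβ]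
        cov1_posDef := kalmanCov_posDef hM.R_posDef hB.cov1_posDef
        cov2_posDef := kalmanCov_posDef hM.R_posDef hB.cov2_posDef }
  | second z =>
    exact
      { r_mem := ⟨zero_le_one, le_rfl⟩
        β1_nonneg := le_rfl
        β2_nonneg := zero_le_one
        β_sum := zero_add 1
        cov1_posDef := hB.cov1_posDef
        cov2_posDef := kalmanCov_posDef hM.R_posDef hB.cov2_posDef }
  | both z =>
    exact
      { r_mem := ⟨zero_le_one, le_rfl⟩
        β1_nonneg := le_rfl
        β2_nonneg := zero_le_one
        β_sum := zero_add 1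
        cov1_posDef := hB.cov1_posDef
        cov2_posDef := kalmanCov_posDef hM.R2_posDef hB.cov2_posDef }

theorem GaussBern.Valid.innerProd_lpD (hB : B.Valid) (hM : M.Valid) (hmarg : B.SameMarginal)
    (Z : TwoStep nz) : innerProd B.density (M.lpD Z) = B.detDensity M Z := by
  rw [innerProd]
  simp_rw [mul_comm (B.density _), hB.lpD_mul_density hM hmarg]
  rw [integral_const_mul]
  -- The updated density is known to be normalised only if the detection density is nonzero;
  -- otherwise the prefactor removes it.
  by_cases h0 : B.detDensity M Z = 0
  · rw [h0, zero_mul]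
  · rw [(hB.detected hM h0).integral_density, mul_one]

theorem GaussBern.detected_r (M : MeasModel nx nz) (B : GaussBern nx) (Z : TwoStep nz) :
    (B.detected M Z).r = 1 := by
  cases Z <;> rfl

end Bernoulli

/-! ### Update of the Poisson intensity and the new targets. -/

section Intensity

variable {M : MeasModel nx nz} {P : GaussPMBM nx nb np h}

theorem GaussPMBM.Valid.v_nonneg (hP : P.Valid) (hM : M.Valid) (Z : TwoStep nz)
    (c : Fin nb ⊕ Fin np) : 0 ≤ P.v M Z c := by
  have h3 := hM.γ_nonneg
  have h4 := hM.pD_mem.1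
  have h5 := hM.pFull_mem.1
  rcases c with q | q
  · have h1 := hP.wB_nonneg q
    cases Z with
    | first z => exact le_rfl
    | second z => exact mul_nonneg (by positivity) (gauss_nonneg _ _ _)
    | both z => exact le_rfl
  · have h1 := hP.wP_nonneg q
    cases Z <;> exact mul_nonneg (by positivity) (gauss_nonneg _ _ _)

theorem GaussPMBM.newComp_nonneg (P : GaussPMBM nx nb np h) (M : MeasModel nx nz)
    (Z : TwoStep nz) (c : Fin nb ⊕ Fin np) (X : TwoStep nx) : 0 ≤ P.newComp M Z c X := by
  rcases c with q | q <;> cases Z <;>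
    first | exact gaussSecond_nonneg _ _ _ | exact gaussBoth_nonneg _ _ _

theorem GaussPMBM.Valid.integrable_newComp (hP : P.Valid) (hM : M.Valid) (Z : TwoStep nz)
    (c : Fin nb ⊕ Fin np) : Integrable (P.newComp M Z c) := by
  rcases c with q | q <;> cases Z
  · exact integrable_gaussSecond _ (hP.covB_posDef q)
  · exact integrable_gaussSecond _ (kalmanCov_posDef hM.R_posDef (hP.covB_posDef q))
  · exact integrable_gaussSecond _ (hP.covB_posDef q)
  · exact integrable_gaussBoth _ (kalmanCov_posDef hM.R_posDef (hP.covP_posDef q))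
  · exact integrable_gaussBoth _ (kalmanCov_posDef hM.R_posDef (hP.covP_posDef q))
  · exact integrable_gaussBoth _ (kalmanCov_posDef hM.R2_posDef (hP.covP_posDef q))

theorem GaussPMBM.Valid.integral_newComp (hP : P.Valid) (hM : M.Valid) (Z : TwoStep nz)
    (c : Fin nb ⊕ Fin np) : ∫ X, P.newComp M Z c X = 1 := by
  rcases c with q | q <;> cases Z
  · exact integral_gaussSecond _ (hP.covB_posDef q)
  · exact integral_gaussSecond _ (kalmanCov_posDef hM.R_posDef (hP.covB_posDef q))
  · exact integral_gaussSecond _ (hP.covB_posDef q)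
  · exact integral_gaussBoth _ (kalmanCov_posDef hM.R_posDef (hP.covP_posDef q))
  · exact integral_gaussBoth _ (kalmanCov_posDef hM.R_posDef (hP.covP_posDef q))
  · exact integral_gaussBoth _ (kalmanCov_posDef hM.R2_posDef (hP.covP_posDef q))

theorem GaussPMBM.Valid.lpD_mul_intensityComp (hP : P.Valid) (hM : M.Valid) (Z : TwoStep nz)
    (c : Fin nb ⊕ Fin np) (X : TwoStep nx) :
    M.lpD Z X * P.intensityComp c X = P.v M Z c * P.newComp M Z c X := by
  rcases c with q | q
  -- Of the nine combinations, only a measurement and a trajectory both at `k+1` survive for a birth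
  -- component. For a surviving component, the three with a two-step trajectory remain.
  · cases Z <;> cases X <;> simp [MeasModel.lpD, MeasModel.l, GaussPMBM.intensityComp,
      GaussPMBM.v, GaussPMBM.newComp, gaussSecond]
    linear_combination M.pD * P.wB q *
      gauss_mul_gauss (H := M.H) hM.R_posDef (hP.covB_posDef q) _ (P.meanB q) _
  · cases Z <;> cases X <;> simp [MeasModel.lpD, MeasModel.l, GaussPMBM.intensityComp,
      GaussPMBM.v, GaussPMBM.newComp, gaussBoth]
    · linear_combination M.pD * P.wP q * M.γ *
        gauss_mul_gauss (H := M.H13) hM.R_posDef (hP.covP_posDef q) _ (P.meanP q) _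
    · linear_combination M.pD * P.wP q * M.γ *
        gauss_mul_gauss (H := M.H23) hM.R_posDef (hP.covP_posDef q) _ (P.meanP q) _
    · linear_combination M.pD * P.wP q * M.pFull *
        gauss_mul_gauss (H := M.H33) hM.R2_posDef (hP.covP_posDef q) _ (P.meanP q) _

theorem GaussPMBM.Valid.innerProd_intensityComp (hP : P.Valid) (hM : M.Valid) (Z : TwoStep nz)
    (c : Fin nb ⊕ Fin np) : innerProd (P.intensityComp c) (M.lpD Z) = P.v M Z c := by
  rw [innerProd]
  simp_rw [mul_comm (P.intensityComp c _), hP.lpD_mul_intensityComp hM]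
  rw [integral_const_mul, hP.integral_newComp hM, mul_one]

theorem GaussPMBM.intensity_eq_sum (P : GaussPMBM nx nb np h) (X : TwoStep nx) :
    P.predicted.intensity X = ∑ c, P.intensityComp c X := by
  rw [Fintype.sum_sum_type]
  rfl

theorem GaussPMBM.vSum_eq_sum (P : GaussPMBM nx nb np h) (M : MeasModel nx nz)
    (Z : TwoStep nz) : P.vSum M Z = ∑ c, P.v M Z c := by
  rw [Fintype.sum_sum_type]
  rfl

theorem GaussPMBM.Valid.lpD_mul_intensity (hP : P.Valid) (hM : M.Valid) (Z : TwoStep nz)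
    (X : TwoStep nx) :
    M.lpD Z X * P.predicted.intensity X = ∑ c, P.v M Z c * P.newComp M Z c X := by
  rw [P.intensity_eq_sum, Finset.mul_sum]
  exact Finset.sum_congr rfl fun c _ => hP.lpD_mul_intensityComp hM Z c X

theorem GaussPMBM.Valid.innerProd_intensity (hP : P.Valid) (hM : M.Valid) (Z : TwoStep nz) :
    innerProd P.predicted.intensity (M.lpD Z) = P.vSum M Z := by
  rw [innerProd]
  simp_rw [mul_comm (P.predicted.intensity _), hP.lpD_mul_intensity hM]
  rw [integral_finsetSum _ fun c _ => (hP.integrable_newComp hM Z c).const_mul _, P.vSum_eq_sum]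
  simp_rw [integral_const_mul, hP.integral_newComp hM, mul_one]

theorem GaussPMBM.Valid.vSum_nonneg (hP : P.Valid) (hM : M.Valid) (Z : TwoStep nz) :
    0 ≤ P.vSum M Z := by
  rw [P.vSum_eq_sum]
  exact Finset.sum_nonneg fun c _ => hP.v_nonneg hM Z c

/-- The multiplied-out form needs no case distinction downstream: if the total is zero, so is each
nonnegative `v`, and the default value of the division is harmless. -/
theorem GaussPMBM.Valid.vSum_mul_newDensity (hP : P.Valid) (hM : M.Valid) (Z : TwoStep nz)
    (X : TwoStep nx) :
    P.vSum M Z * P.newDensity M Z X = M.lpD Z X * P.predicted.intensity X := by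
  rw [hP.lpD_mul_intensity hM, GaussPMBM.newDensity, Finset.mul_sum]
  refine Finset.sum_congr rfl fun c _ => ?_
  by_cases h0 : P.vSum M Z = 0
  · have hc : P.v M Z c = 0 := (Finset.sum_eq_zero_iff_of_nonneg fun c _ => hP.v_nonneg hM Z c).1
      (P.vSum_eq_sum M Z ▸ h0) c (Finset.mem_univ c)
    rw [h0, hc]
    ring
  · field_simp

theorem GaussPMBM.Valid.newDensity_nonneg (hP : P.Valid) (hM : M.Valid) (Z : TwoStep nz)
    (X : TwoStep nx) : 0 ≤ P.newDensity M Z X :=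
  Finset.sum_nonneg fun c _ => mul_nonneg (div_nonneg (hP.v_nonneg hM Z c) (hP.vSum_nonneg hM Z))
    (P.newComp_nonneg M Z c X)

theorem GaussPMBM.Valid.integral_newDensity (hP : P.Valid) (hM : M.Valid) {Z : TwoStep nz}
    (h0 : P.vSum M Z ≠ 0) : ∫ X, P.newDensity M Z X = 1 := by
  simp only [GaussPMBM.newDensity]
  rw [integral_finsetSum _ fun c _ => (hP.integrable_newComp hM Z c).const_mul _]
  simp_rw [integral_const_mul, hP.integral_newComp hM, mul_one]
  rw [← Finset.sum_div, ← P.vSum_eq_sum, div_self h0]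

theorem GaussPMBM.Valid.newWeight_nonneg (hP : P.Valid) (hM : M.Valid) (Z : TwoStep nz) :
    0 ≤ P.newWeight M Z :=
  add_nonneg (hM.clutter_nonneg Z) (hP.vSum_nonneg hM Z)

theorem GaussPMBM.Valid.newR_mem (hP : P.Valid) (hM : M.Valid) (Z : TwoStep nz) :
    P.newR M Z ∈ Set.Icc (0 : ℝ) 1 :=
  ⟨div_nonneg (hP.vSum_nonneg hM Z) (hP.newWeight_nonneg hM Z),
    div_le_one_of_le₀ (le_add_of_nonneg_left (hM.clutter_nonneg Z)) (hP.newWeight_nonneg hM Z)⟩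

theorem GaussPMBM.Valid.newWeight_mul_newR (hP : P.Valid) (hM : M.Valid) (Z : TwoStep nz) :
    P.newWeight M Z * P.newR M Z = P.vSum M Z := by
  by_cases h0 : P.newWeight M Z = 0
  · have h1 := hM.clutter_nonneg Z
    have h2 := hP.vSum_nonneg hM Z
    have h3 : P.vSum M Z = 0 := by
      rw [GaussPMBM.newWeight] at h0
      linarith
    rw [h0, h3, zero_mul]
  · exact mul_div_cancel₀ _ h0

theorem GaussPMBM.Valid.intensity_nonneg (hP : P.Valid) (X : TwoStep nx) :
    0 ≤ P.predicted.intensity X :=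
  add_nonneg (Finset.sum_nonneg fun q _ => mul_nonneg (hP.wB_nonneg q) (gaussSecond_nonneg _ _ _))
    (Finset.sum_nonneg fun q _ => mul_nonneg (hP.wP_nonneg q) (gaussBoth_nonneg _ _ _))

theorem GaussPMBM.Valid.integrable_intensity (hP : P.Valid) :
    Integrable P.predicted.intensity :=
  (integrable_finsetSum _ fun q _ => (integrable_gaussSecond _ (hP.covB_posDef q)).const_mul _).add
    (integrable_finsetSum _ fun q _ => (integrable_gaussBoth _ (hP.covP_posDef q)).const_mul _)

theorem GaussPMBM.updated_intensity (P : GaussPMBM nx nb np h) (M : MeasModel nx nz)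
    (Z : Fin m → TwoStep nz) :
    (P.updated M Z).intensity = fun X => (1 - M.pD) * P.predicted.intensity X := by
  funext X
  simp only [GaussPMBM.updated, GaussPMBM.predicted, mul_add, Finset.mul_sum, mul_assoc]

end Intensity

/-! ### Poisson thinning as a factorisation of square-zero products. -/

section SquareZeroProducts

variable {α R : Type} [CommRing R]

/-- All cross terms contain `u * u`. The lemma is used both with `u` a trajectory variable and with
`u` a measurement variable. -/
theorem prod_one_add_mul {ι : Type} {u : R} (hu : u * u = 0) (s : Finset ι) (a : ι → R) :
    ∏ i ∈ s, (1 + u * a i) = 1 + u * ∑ i ∈ s, a i := by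
  classical
  induction s using Finset.induction_on with
  | empty => simp
  | insert i s hi ih =>
    rw [Finset.prod_insert hi, Finset.sum_insert hi, ih]
    linear_combination (a i * ∑ i ∈ s, a i) * hu

variable [Algebra ℝ R]

/-- Splitting of a Poisson process into its undetected part and the parts detected by each
measurement, at the level of generating elements. -/
theorem poisson_thinning {m : ℕ} {e : α → R} {Y : Fin m → R} (he : ∀ x, e x * e x = 0)
    (hY : ∀ j, Y j * Y j = 0) (X : Finset α) (p : ℝ) (lam : α → ℝ) (clut : Fin m → ℝ)
    (l : Fin m → α → ℝ) :
    (∏ j, (1 + clut j • Y j)) *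
        ∏ x ∈ X, (1 + lam x • (((1 - p) • (1 : R) + ∑ j, (l j x * p) • Y j) * e x)) =
      (∏ x ∈ X, (1 + ((1 - p) * lam x) • e x)) *
        ∏ j, (1 + Y j * (clut j • (1 : R) + ∑ x ∈ X, (l j x * p * lam x) • e x)) := by
  -- For a fixed trajectory, `e x * e x = 0` splits its factor into an undetected part and one part
  -- per measurement.
  have h1 : ∀ x, 1 + lam x • (((1 - p) • (1 : R) + ∑ j, (l j x * p) • Y j) * e x) =
      (1 + ((1 - p) * lam x) • e x) * ∏ j, (1 + Y j * ((l j x * p * lam x) • e x)) := by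
    intro x
    have h2 : ∀ j, 1 + Y j * ((l j x * p * lam x) • e x) =
        1 + e x * (lam x • ((l j x * p) • Y j)) := by
      intro j
      simp only [Algebra.smul_def, map_mul]
      ring
    simp_rw [h2]
    rw [prod_one_add_mul (he x), ← Finset.smul_sum]
    set s := ∑ j, (l j x * p) • Y j
    simp only [Algebra.smul_def, map_mul, map_sub, map_one, mul_one]
    linear_combination
      (-(1 - algebraMap ℝ R p) * algebraMap ℝ R (lam x) * algebraMap ℝ R (lam x) * s) * he x
  -- For a fixed measurement, `Y j * Y j = 0` makes clutter and detections mutually exclusive.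
  -- Exchanging the two products then finishes the proof.
  have h3 : ∀ j, 1 + Y j * (clut j • (1 : R) + ∑ x ∈ X, (l j x * p * lam x) • e x) =
      (1 + clut j • Y j) * ∏ x ∈ X, (1 + Y j * ((l j x * p * lam x) • e x)) := by
    intro j
    rw [prod_one_add_mul (hY j)]
    set s := ∑ x ∈ X, (l j x * p * lam x) • e x
    simp only [Algebra.smul_def, mul_one]
    linear_combination (-algebraMap ℝ R (clut j) * s) * hY j
  simp_rw [h1, h3]
  rw [Finset.prod_mul_distrib, Finset.prod_mul_distrib, Finset.prod_comm]
  ring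

end SquareZeroProducts

/-! ### Expansion of the joint generating element over updated hypotheses. -/

section Update

open scoped Classical

variable {nx nz n m nb np : ℕ} {h : Fin n → ℕ} {R : Type} [CommRing R]

/-- An updated hypothesis of an existing target. -/
def LocalHyp.existing (i : Fin n) (a : Fin (h i)) (o : Option (Fin m)) :
    LocalHyp h m (.inl i) := (a, o)

/-- An updated hypothesis of a new target. -/
def LocalHyp.fresh (h : Fin n → ℕ) (j : Fin m) (b : Bool) : LocalHyp h m (.inr j) := b

/-- Product over `j` of the marks `Y j` of the measurements used by a single-target hypothesis. -/
def LocalHyp.mark (Y : Fin m → R) (t : Fin n ⊕ Fin m) (a : LocalHyp h m t) : R :=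
  ∏ j, if LocalHyp.Uses j t a then Y j else 1

theorem LocalHyp.mark_missed (Y : Fin m → R) (i : Fin n) (a : Fin (h i)) :
    LocalHyp.mark Y (.inl i) (LocalHyp.existing i a none) = 1 := by
  refine Finset.prod_eq_one fun j _ => if_neg ?_
  simp [LocalHyp.Uses, LocalHyp.existing]

theorem LocalHyp.mark_detected (Y : Fin m → R) (i : Fin n) (a : Fin (h i)) (j : Fin m) :
    LocalHyp.mark Y (.inl i) (LocalHyp.existing i a (some j)) = Y j := by
  simp only [LocalHyp.mark, LocalHyp.Uses, LocalHyp.existing, Option.some.injEq]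
  rw [Finset.prod_ite_eq, if_pos (Finset.mem_univ j)]

theorem LocalHyp.mark_new_false (Y : Fin m → R) (j : Fin m) :
    LocalHyp.mark Y (.inr j) (LocalHyp.fresh h j false) = 1 := by
  refine Finset.prod_eq_one fun j _ => if_neg ?_
  simp [LocalHyp.Uses, LocalHyp.fresh]

theorem LocalHyp.mark_new_true (Y : Fin m → R) (j : Fin m) :
    LocalHyp.mark Y (.inr j) (LocalHyp.fresh h j true) = Y j := by
  simp only [LocalHyp.mark, LocalHyp.Uses, LocalHyp.fresh, and_true]
  rw [Finset.prod_ite_eq', if_pos (Finset.mem_univ j)]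

/-- The exponent of `Y j` counts the targets that use measurement `j`, so the association constraint
can be read off as a coefficient. -/
theorem prod_mark (Y : Fin m → R) (a : ∀ t, LocalHyp h m t) :
    ∏ t, LocalHyp.mark Y t (a t) =
      ∏ j, Y j ^ (Finset.univ.filter fun t => LocalHyp.Uses j t (a t)).card := by
  unfold LocalHyp.mark
  rw [Finset.prod_comm]
  refine Finset.prod_congr rfl fun j _ => ?_
  rw [← Finset.prod_filter, Finset.prod_const]

/-- Extensions of a predicted global hypothesis, target by target. -/
def childHyp (m : ℕ) (a : ∀ i, Fin (h i)) : ∀ t : Fin n ⊕ Fin m, Finset (LocalHyp h m t)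
  | .inl i => ({a i} ×ˢ Finset.univ : Finset (Fin (h i) × Option (Fin m)))
  | .inr _ => (Finset.univ : Finset Bool)

theorem mem_piFinset_childHyp (a : ∀ i, Fin (h i)) (b : ∀ t, LocalHyp h m t) :
    b ∈ Fintype.piFinset (childHyp m a) ↔ parent b = a := by
  rw [Fintype.mem_piFinset]
  constructor
  · intro hb
    funext i
    have := hb (.inl i)
    exact Finset.mem_singleton.1 (Finset.mem_product.1 this).1
  · rintro rfl (i | j)
    · exact Finset.mem_product.2 ⟨Finset.mem_singleton.2 rfl, Finset.mem_univ _⟩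
    · exact Finset.mem_univ (α := Bool) _

/-- Distributivity: choosing a detection outcome for every old and new target is the same as
choosing an updated global hypothesis with the given parent. -/
theorem prod_sum_localHyp (a : ∀ i, Fin (h i)) (G : ∀ t, LocalHyp h m t → R) :
    (∏ i, ∑ o : Option (Fin m), G (.inl i) (LocalHyp.existing i (a i) o)) * ∏ j, ∑ b : Bool, G (.inr j) (LocalHyp.fresh h j b) =
      ∑ b : ∀ t, LocalHyp h m t with parent b = a, ∏ t, G t (b t) := by
  have h1 : (Finset.univ.filter fun b : ∀ t, LocalHyp h m t => parent b = a) =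
      Fintype.piFinset (childHyp m a) := by
    ext b
    rw [mem_piFinset_childHyp]
    simp
  rw [h1, ← Finset.prod_univ_sum, Fintype.prod_sum_type]
  congr 1
  refine Finset.prod_congr rfl fun i _ => ?_
  exact ((Finset.sum_product _ _ _).trans (Finset.sum_singleton _ _)).symm

variable [Algebra ℝ R] {M : MeasModel nx nz} {P : GaussPMBM nx nb np h}

/-- Weighted and marked generating element of an updated single-target hypothesis. -/
def GaussPMBM.localGen (P : GaussPMBM nx nb np h) (M : MeasModel nx nz) (Z : Fin m → TwoStep nz)
    (e : TwoStep nx → R) (Y : Fin m → R) (X : Finset (TwoStep nx)) (t : Fin n ⊕ Fin m)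
    (a : LocalHyp h m t) : R :=
  LocalHyp.mark Y t a * (P.localWeight M Z t a •
    gen e X (bernoulliDensity (P.localR M Z t a) (P.localDensity M Z t a)))

/-- Only the products `w (1 - r)` and `w r p` enter, so existence probabilities defined by division
never need a nonzero denominator. -/
theorem smul_gen_bernoulliDensity {α : Type} (e : α → R) (X : Finset α) {w r c : ℝ}
    {p q : α → ℝ} (hc : w * (1 - r) = c) (hq : ∀ x, w * r * p x = q x) :
    w • gen e X (bernoulliDensity r p) = c • (1 : R) + ∑ x ∈ X, q x • e x := by
  rw [gen_bernoulliDensity, smul_add, smul_smul, hc, Finset.smul_sum]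
  simp_rw [smul_smul, ← mul_assoc, hq]

/-- The right-hand side is the predicted Bernoulli element with `e x` replaced by `c x * e x`. Its
part free of `Y` is the missed detection, and its `Y j` part is the detection by `Z j`. -/
theorem GaussPMBM.Valid.sum_localGen_existing (hP : P.Valid) (hM : M.Valid)
    (hmarg : ∀ i a, (P.bern i a).SameMarginal) (Z : Fin m → TwoStep nz)
    (e : TwoStep nx → R) (Y : Fin m → R) (X : Finset (TwoStep nx)) (i : Fin n) (a : Fin (h i)) :
    ∑ o : Option (Fin m), P.localGen M Z e Y X (.inl i) (LocalHyp.existing i a o) =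
      (1 - (P.bern i a).r) • (1 : R) + ∑ x ∈ X, ((P.bern i a).r * (P.bern i a).density x) •
        (((1 - M.pD) • (1 : R) + ∑ j, (M.l (Z j) x * M.pD) • Y j) * e x) := by
  have hB := hP.bern_valid i a
  set B := P.bern i a with hBdef
  have h0 : P.localGen M Z e Y X (.inl i) (LocalHyp.existing i a none) =
      (1 - B.r) • (1 : R) + ∑ x ∈ X, (B.r * (1 - M.pD) * B.density x) • e x := by
    rw [GaussPMBM.localGen, LocalHyp.mark_missed, one_mul]
    exact smul_gen_bernoulliDensity e X (hB.missedWeight_mul_one_sub_r hM)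
      fun x => by rw [← hB.missedWeight_mul_r hM]; rfl
  have h1 : ∀ j, P.localGen M Z e Y X (.inl i) (LocalHyp.existing i a (some j)) =
      Y j * ∑ x ∈ X, (B.r * (M.lpD (Z j) x * B.density x)) • e x := by
    intro j
    rw [GaussPMBM.localGen, LocalHyp.mark_detected]
    congr 1
    refine (smul_gen_bernoulliDensity e X (c := 0)
      (q := fun x => B.r * (M.lpD (Z j) x * B.density x)) ?_ fun x => ?_).trans (by simp)
    · change B.detWeight M (Z j) * (1 - (B.detected M (Z j)).r) = 0
      rw [GaussBern.detected_r, sub_self, mul_zero]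
    · change B.detWeight M (Z j) * (B.detected M (Z j)).r * (B.detected M (Z j)).density x = _
      rw [GaussBern.detected_r, hB.lpD_mul_density hM (hmarg i a), B.detWeight_eq]
      ring
  rw [Fintype.sum_option, h0]
  simp_rw [h1, Finset.mul_sum]
  rw [Finset.sum_comm, add_assoc, ← Finset.sum_add_distrib]
  congr 1
  refine Finset.sum_congr rfl fun x _ => ?_
  rw [add_mul, smul_add, Finset.sum_mul, Finset.smul_sum]
  congr 1
  · rw [smul_mul_assoc, one_mul, smul_smul]
    congr 1
    ring
  · refine Finset.sum_congr rfl fun j _ => ?_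
    simp only [MeasModel.lpD, Algebra.smul_def, map_mul]
    ring

/-- The factor of measurement `j` in `poisson_thinning`: `1` is the undetected hypothesis, and the
multiple of `Y j` merges clutter with a first detection of a Poisson trajectory. -/
theorem GaussPMBM.Valid.sum_localGen_new (hP : P.Valid) (hM : M.Valid) (Z : Fin m → TwoStep nz)
    (e : TwoStep nx → R) (Y : Fin m → R) (X : Finset (TwoStep nx)) (j : Fin m) :
    ∑ b : Bool, P.localGen M Z e Y X (.inr j) (LocalHyp.fresh h j b) =
      1 + Y j * (M.clutter (Z j) • (1 : R) +
        ∑ x ∈ X, (M.l (Z j) x * M.pD * P.predicted.intensity x) • e x) := by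
  have h0 : P.localGen M Z e Y X (.inr j) (LocalHyp.fresh h j false) = 1 := by
    rw [GaussPMBM.localGen, LocalHyp.mark_new_false, one_mul]
    refine (smul_gen_bernoulliDensity e X (c := 1) (q := fun _ => 0) ?_ fun x => ?_).trans (by simp)
    · change (1 : ℝ) * (1 - 0) = 1
      ring
    · exact mul_zero _
  have h1 : P.localGen M Z e Y X (.inr j) (LocalHyp.fresh h j true) = Y j * (M.clutter (Z j) • (1 : R) +
        ∑ x ∈ X, (M.l (Z j) x * M.pD * P.predicted.intensity x) • e x) := by
    rw [GaussPMBM.localGen, LocalHyp.mark_new_true]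
    congr 1
    refine smul_gen_bernoulliDensity e X ?_ fun x => ?_
    · change P.newWeight M (Z j) * (1 - P.newR M (Z j)) = _
      rw [mul_sub, hP.newWeight_mul_newR hM, GaussPMBM.newWeight]
      ring
    · change P.newWeight M (Z j) * P.newR M (Z j) * P.newDensity M (Z j) x = _
      rw [hP.newWeight_mul_newR hM, hP.vSum_mul_newDensity hM]
      rfl
  rw [Fintype.sum_bool, h0, h1, add_comm]

/-- The Poisson multi-Bernoulli density of an updated global hypothesis. -/
def GaussPMBM.updatedComponent (P : GaussPMBM nx nb np h) (M : MeasModel nx nz)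
    (Z : Fin m → TwoStep nz) (b : ∀ t, LocalHyp h m t) : Finset (TwoStep nx) → ℝ :=
  conv (pppDensity (P.updated M Z).intensity)
    (familyConv fun t => bernoulliDensity (P.localR M Z t (b t)) (P.localDensity M Z t (b t)))

theorem GaussPMBM.prod_localGen (P : GaussPMBM nx nb np h) (M : MeasModel nx nz)
    (Z : Fin m → TwoStep nz) {e : TwoStep nx → R} (he : ∀ x, e x * e x = 0) (Y : Fin m → R)
    (X : Finset (TwoStep nx)) (b : ∀ t, LocalHyp h m t) :
    gen e X (pppDensity (P.updated M Z).intensity) * ∏ t, P.localGen M Z e Y X t (b t) =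
      (∏ t, P.localWeight M Z t (b t)) •
        ((∏ t, LocalHyp.mark Y t (b t)) * gen e X (P.updatedComponent M Z b)) := by
  simp only [GaussPMBM.localGen]
  rw [Finset.prod_mul_distrib, Finset.prod_smul, prod_gen he, GaussPMBM.updatedComponent,
    ← gen_mul_gen he, mul_smul_comm, mul_smul_comm]
  congr 1
  ring

theorem gen_density {d : ℕ} {ι : Type} [Fintype ι] {hyp : ι → Type} (f : PMBM d ι hyp)
    {e : TwoStep d → R} (he : ∀ x, e x * e x = 0) (X : Finset (TwoStep d)) :
    gen e X f.density = gen e X (pppDensity f.intensity) *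
      ∑ a ∈ f.globalHyp, f.weight a •
        ∏ i, gen e X (bernoulliDensity (f.r i (a i)) (f.p i (a i))) := by
  rw [PMBM.density, ← gen_mul_gen he]
  congr 1
  change gen e X (fun T => ∑ a ∈ f.globalHyp, f.weight a *
    familyConv (fun i => bernoulliDensity (f.r i (a i)) (f.p i (a i))) T) = _
  rw [gen_sum_mul]
  simp_rw [prod_gen he]

/-- Normalisation factor relating the clutter, predicted and updated Poisson densities. -/
def GaussPMBM.updateConst (P : GaussPMBM nx nb np h) (M : MeasModel nx nz) : ℝ :=
  Real.exp (-∫ z, M.clutter z) * Real.exp (-∫ x, P.predicted.intensity x) *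
    Real.exp (∫ x, (1 - M.pD) * P.predicted.intensity x)

/-- The joint generating element of trajectories and measurements, expanded over the updated
hypotheses. -/
theorem GaussPMBM.Valid.joint_gen (hP : P.Valid) (hM : M.Valid)
    (hmarg : ∀ i a, (P.bern i a).SameMarginal) (Z : Fin m → TwoStep nz)
    {e : TwoStep nx → R} (he : ∀ x, e x * e x = 0) {Y : Fin m → R} (hY : ∀ j, Y j * Y j = 0)
    (X : Finset (TwoStep nx)) :
    (Real.exp (-∫ z, M.clutter z) • ∏ j, (1 + M.clutter (Z j) • Y j)) *
        gen (fun x => ((1 - M.pD) • (1 : R) + ∑ j, (M.l (Z j) x * M.pD) • Y j) * e x) X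
          P.predicted.density =
      P.updateConst M • ∑ b : ∀ t, LocalHyp h m t with parent b ∈ P.globalHyp,
        P.rawWeight M Z b • ((∏ t, LocalHyp.mark Y t (b t)) *
          gen e X (P.updatedComponent M Z b)) := by
  -- The rescaled variables still square to zero, so the generating-element calculus applies to
  -- them.
  have he' : ∀ x, (((1 - M.pD) • (1 : R) + ∑ j, (M.l (Z j) x * M.pD) • Y j) * e x) *
      (((1 - M.pD) • (1 : R) + ∑ j, (M.l (Z j) x * M.pD) • Y j) * e x) = 0 := by
    intro x
    rw [mul_mul_mul_comm, he, mul_zero]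
  have hppp : gen e X (pppDensity (P.updated M Z).intensity) =
      Real.exp (-∫ x, (1 - M.pD) * P.predicted.intensity x) •
        ∏ x ∈ X, (1 + ((1 - M.pD) * P.predicted.intensity x) • e x) := by
    rw [gen_pppDensity, P.updated_intensity]
  have hbern : ∀ (a : ∀ i, Fin (h i)) (i : Fin n),
      gen (fun x => ((1 - M.pD) • (1 : R) + ∑ j, (M.l (Z j) x * M.pD) • Y j) * e x) X
        (bernoulliDensity (P.predicted.r i (a i)) (P.predicted.p i (a i))) =
        ∑ o : Option (Fin m), P.localGen M Z e Y X (.inl i) (LocalHyp.existing i (a i) o) := by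
    intro a i
    rw [gen_bernoulliDensity, hP.sum_localGen_existing hM hmarg]
    rfl
  have hthin := poisson_thinning he hY X M.pD P.predicted.intensity (fun j => M.clutter (Z j))
    fun j x => M.l (Z j) x
  simp_rw [← hP.sum_localGen_new hM] at hthin
  have hraw : ∀ b : ∀ t, LocalHyp h m t,
      P.rawWeight M Z b • ((∏ t, LocalHyp.mark Y t (b t)) * gen e X (P.updatedComponent M Z b)) =
      P.weight (parent b) • (gen e X (pppDensity (P.updated M Z).intensity) *
        ∏ t, P.localGen M Z e Y X t (b t)) := by
    intro b
    rw [P.prod_localGen M Z he, smul_smul, GaussPMBM.rawWeight]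
  simp_rw [hraw]
  -- The updated hypotheses are grouped by their parent, so that each group is an expanded product.
  rw [← Finset.sum_fiberwise_eq_sum_filter]
  have hfib : ∀ a ∈ P.globalHyp, ∑ b : ∀ t, LocalHyp h m t with parent b = a,
      P.weight (parent b) • (gen e X (pppDensity (P.updated M Z).intensity) *
        ∏ t, P.localGen M Z e Y X t (b t)) =
      gen e X (pppDensity (P.updated M Z).intensity) *
        (∏ j, ∑ b : Bool, P.localGen M Z e Y X (.inr j) (LocalHyp.fresh h j b)) *
        (P.weight a • ∏ i, ∑ o : Option (Fin m), P.localGen M Z e Y X (.inl i) (LocalHyp.existing i (a i) o)) := by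
    intro a _
    have h2 := prod_sum_localHyp a (P.localGen M Z e Y X)
    rw [mul_smul_comm, mul_assoc, mul_comm (∏ j, _), h2, Finset.mul_sum, Finset.smul_sum]
    refine Finset.sum_congr rfl fun b hb => ?_
    rw [(Finset.mem_filter.1 hb).2]
  rw [Finset.sum_congr rfl hfib, ← Finset.mul_sum, gen_density _ he', gen_pppDensity, hppp]
  simp_rw [hbern]
  change _ * ((_ • _) * ∑ a ∈ P.globalHyp, P.weight a • _) = _
  set Q := ∑ a ∈ P.globalHyp,
    P.weight a • ∏ i, ∑ o : Option (Fin m), P.localGen M Z e Y X (.inl i) (LocalHyp.existing i (a i) o)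
  rw [← mul_assoc, smul_mul_smul_comm, hthin]
  simp only [smul_mul_assoc, smul_smul]
  -- The last factor of `updateConst` compensates the normalisation of the thinned Poisson density.
  rw [GaussPMBM.updateConst, mul_assoc (_ * _),
    ← Real.exp_add (∫ x, (1 - M.pD) * P.predicted.intensity x), add_neg_cancel, Real.exp_zero,
    mul_one]

end Update

/-! ### Extraction of the joint density as a double top coefficient. -/

section Coefficients

open scoped Classical

variable {nx nz n m nb np : ℕ} {h : Fin n → ℕ} {M : MeasModel nx nz} {P : GaussPMBM nx nb np h}

theorem card_filter_eq_one_iff_existsUnique {ι : Type} [Fintype ι] (p : ι → Prop) :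
    (Finset.univ.filter p).card = 1 ↔ ∃! t, p t := by
  rw [Finset.card_eq_one]
  constructor
  · rintro ⟨t, ht⟩
    have hmem : ∀ s, p s ↔ s = t := fun s => by
      rw [← Finset.mem_singleton, ← ht]
      simp
    exact ⟨t, (hmem t).2 rfl, fun s hs => (hmem s).1 hs⟩
  · rintro ⟨t, ht, huniq⟩
    refine ⟨t, ?_⟩
    ext s
    simp only [Finset.mem_filter, Finset.mem_univ, true_and, Finset.mem_singleton]
    exact ⟨fun hs => huniq s hs, fun hs => hs ▸ ht⟩

/-- The coefficient extracts the hypotheses that use each measurement exactly once. -/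
theorem SqZero.coeff_prod_mark {β : Type} (Z : Fin m ↪ β) (b : ∀ t, LocalHyp h m t) :
    SqZero.coeff (Finset.univ.map Z)
        (∏ t, LocalHyp.mark (fun j => (SqZero.var (Z j) : SqZero β ℝ)) t (b t)) =
      if ∀ j : Fin m, ∃! t, LocalHyp.Uses j t (b t) then 1 else 0 := by
  -- The exponents are indexed by `j`; they are carried along `Z` to points of `β`, with the
  -- irrelevant value zero off the range.
  have h1 := SqZero.coeff_prod_var_pow (S := ℝ) (Finset.univ.map Z)
    (Function.extend Z (fun j => (Finset.univ.filter fun t => LocalHyp.Uses j t (b t)).card) 0)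
  simp only [Finset.prod_map, Finset.forall_mem_map, Finset.mem_univ, true_implies,
    Z.injective.extend_apply, card_filter_eq_one_iff_existsUnique] at h1
  rw [prod_mark, h1]

/-- For a fixed trajectory set, the measurements are Poisson clutter together with one Bernoulli
process per trajectory, so the element factorises over the trajectories. -/
theorem gen_likelihood (M : MeasModel nx nz) (Z : Fin m ↪ TwoStep nz) (X : Finset (TwoStep nx)) :
    gen (fun z => (SqZero.var z : SqZero (TwoStep nz) ℝ)) (Finset.univ.map Z)
        (fun W => M.likelihood W X) =
      (Real.exp (-∫ z, M.clutter z) • ∏ j, (1 + M.clutter (Z j) • SqZero.var (Z j))) *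
        ∏ x ∈ X, ((1 - M.pD) • 1 + ∑ j, (M.l (Z j) x * M.pD) • SqZero.var (Z j)) := by
  unfold MeasModel.likelihood
  rw [← gen_mul_gen SqZero.var_mul_self, gen_pppDensity, ← prod_gen SqZero.var_mul_self,
    Finset.prod_map, ← Finset.prod_coe_sort X]
  congr 1
  refine Finset.prod_congr rfl fun x _ => ?_
  rw [gen_bernoulliDensity, Finset.sum_map]
  simp_rw [mul_comm M.pD]

theorem map_mark {R S : Type} [CommRing R] [CommRing S] (φ : S →+* R) (Y : Fin m → S)
    (t : Fin n ⊕ Fin m) (a : LocalHyp h m t) :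
    φ (LocalHyp.mark Y t a) = LocalHyp.mark (fun j => φ (Y j)) t a := by
  unfold LocalHyp.mark
  rw [map_prod]
  refine Finset.prod_congr rfl fun j _ => ?_
  rw [apply_ite φ, map_one]

/-- The joint density of measurements and trajectories is an unnormalised PMBM in the
trajectories. -/
theorem GaussPMBM.Valid.likelihood_mul_density (hP : P.Valid) (hM : M.Valid)
    (hmarg : ∀ i a, (P.bern i a).SameMarginal) (Z : Fin m ↪ TwoStep nz)
    (X : Finset (TwoStep nx)) :
    M.likelihood (Finset.univ.map Z) X * P.predicted.density X =
      P.updateConst M * ∑ b ∈ P.updatedHyp m, P.rawWeight M Z b * P.updatedComponent M Z b X := by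
  let S := SqZero (TwoStep nz) ℝ
  -- The trajectory variables are adjoined over the measurement ring, so that measurement variables
  -- act as scalars for the trajectory coefficient.
  let R := SqZero (TwoStep nx) S
  let φ : S →ₐ[ℝ] R := IsScalarTower.toAlgHom ℝ S R
  have hφ : ∀ s : S, φ s = algebraMap S R s := fun _ => rfl
  let y : Fin m → S := fun j => SqZero.var (Z j)
  have hy : ∀ j, y j * y j = 0 := fun j => SqZero.var_mul_self _
  let c : TwoStep nx → S := fun x => (1 - M.pD) • 1 + ∑ j, (M.l (Z j) x * M.pD) • y j
  let q : S := Real.exp (-∫ z, M.clutter z) • ∏ j, (1 + M.clutter (Z j) • y j)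
  have hY : ∀ j, φ (y j) * φ (y j) = 0 := fun j => by rw [← map_mul, hy, map_zero]
  have hc : ∀ x, c x • (SqZero.var x : R) =
      ((1 - M.pD) • (1 : R) + ∑ j, (M.l (Z j) x * M.pD) • φ (y j)) * SqZero.var x := by
    intro x
    refine (Algebra.smul_def (c x) (SqZero.var x : R)).trans ?_
    rw [← hφ]
    simp only [c, map_add, map_sum, map_smul, map_one]
  have hq : φ q = Real.exp (-∫ z, M.clutter z) • ∏ j, (1 + M.clutter (Z j) • φ (y j)) := by
    simp only [q, map_smul, map_prod, map_add, map_one]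
  have hjoint := hP.joint_gen hM hmarg Z (e := fun x => (SqZero.var x : R)) SqZero.var_mul_self
    hY X
  rw [← hq] at hjoint
  simp_rw [← hc] at hjoint
  -- The rescaling contributes `∏_{x ∈ X} c x` to the top coefficient, which with the clutter factor
  -- `q` is the generating element of the likelihood.
  have hleft : SqZero.coeff X (φ q * gen (fun x => c x • (SqZero.var x : R)) X
      P.predicted.density) = P.predicted.density X •
        gen (fun z => (SqZero.var z : S)) (Finset.univ.map Z) (fun W => M.likelihood W X) := by
    rw [hφ, ← Algebra.smul_def, map_smul, SqZero.coeff_gen_smul, gen_likelihood, smul_eq_mul,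
      mul_smul_comm]
  have hright : ∀ b : ∀ t, LocalHyp h m t,
      SqZero.coeff X ((∏ t, LocalHyp.mark (fun j => φ (y j)) t (b t)) *
        gen (fun x => (SqZero.var x : R)) X (P.updatedComponent M Z b)) =
      P.updatedComponent M Z b X • ∏ t, LocalHyp.mark y t (b t) := by
    intro b
    have h1 : ∏ t, LocalHyp.mark (fun j => φ (y j)) t (b t) =
        algebraMap S R (∏ t, LocalHyp.mark y t (b t)) := by
      rw [map_prod]
      exact Finset.prod_congr rfl fun t _ => (map_mark (algebraMap S R) y t (b t)).symm
    rw [h1, ← Algebra.smul_def, map_smul, SqZero.coeff_gen, smul_eq_mul, mul_comm,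
      ← Algebra.smul_def]
  have hlin : ∀ (r : ℝ) (x : R), SqZero.coeff X (r • x) = r • SqZero.coeff X x := by
    intro r x
    rw [← algebraMap_smul S r x, map_smul, algebraMap_smul]
  -- The coefficient in the trajectories is taken first, then the one in the measurements.
  have h1 := congrArg (fun x => SqZero.coeff (Finset.univ.map Z) (SqZero.coeff X x)) hjoint
  simp only [hleft, hlin, map_sum, hright, map_smul, SqZero.coeff_gen] at h1
  rw [mul_comm]
  refine h1.trans ?_
  rw [smul_eq_mul]
  congr 1
  have h2 : P.updatedHyp m = (Finset.univ.filter fun b : ∀ t, LocalHyp h m t =>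
      parent b ∈ P.globalHyp).filter fun b => ∀ j : Fin m, ∃! t, LocalHyp.Uses j t (b t) := by
    rw [Finset.filter_filter]
    rfl
  rw [h2]
  conv_rhs => rw [Finset.sum_filter]
  refine Finset.sum_congr rfl fun b _ => ?_
  rw [SqZero.coeff_prod_mark]
  split_ifs <;> simp

end Coefficients

/-! ### Normalisation, Bayes' rule and admissibility of the updated parameters. -/

section Posterior

open scoped Classical

variable {nx nz n m nb np : ℕ} {h : Fin n → ℕ} {M : MeasModel nx nz} {P : GaussPMBM nx nb np h}

theorem GaussPMBM.Valid.localWeight_nonneg (hP : P.Valid) (hM : M.Valid)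
    (Z : Fin m → TwoStep nz) (t : Fin n ⊕ Fin m) (a : LocalHyp h m t) :
    0 ≤ P.localWeight M Z t a := by
  rcases t with i | j
  · obtain ⟨a, _ | j⟩ := a
    · exact (hP.bern_valid i a).missedWeight_nonneg hM
    · have h1 : 0 ≤ (P.bern i a).detWeight M (Z j) := by
        rw [GaussBern.detWeight_eq]
        exact mul_nonneg (hP.bern_valid i a).r_mem.1
          ((hP.bern_valid i a).detDensity_nonneg hM (Z j))
      exact h1
  · cases a
    · exact zero_le_one
    · exact hP.newWeight_nonneg hM (Z j)

theorem GaussPMBM.Valid.localR_mem (hP : P.Valid) (hM : M.Valid)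
    (Z : Fin m → TwoStep nz) (t : Fin n ⊕ Fin m) (a : LocalHyp h m t) :
    P.localR M Z t a ∈ Set.Icc (0 : ℝ) 1 := by
  rcases t with i | j
  · obtain ⟨a, _ | j⟩ := a
    · exact ((hP.bern_valid i a).missed hM).r_mem
    · have h1 : ((P.bern i a).detected M (Z j)).r ∈ Set.Icc (0 : ℝ) 1 := by
        rw [GaussBern.detected_r]
        exact ⟨zero_le_one, le_rfl⟩
      exact h1
  · cases a
    · exact ⟨le_rfl, zero_le_one⟩
    · exact hP.newR_mem hM (Z j)

/-- Zero local weight or existence probability must be excluded: there the normaliser of a mixture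
may vanish, or the density may be the placeholder zero. -/
theorem GaussPMBM.Valid.localDensity_isDensity (hP : P.Valid) (hM : M.Valid)
    (Z : Fin m → TwoStep nz) (t : Fin n ⊕ Fin m) (a : LocalHyp h m t)
    (hw : P.localWeight M Z t a ≠ 0) (hr : P.localR M Z t a ≠ 0) :
    (∀ X, 0 ≤ P.localDensity M Z t a X) ∧ ∫ X, P.localDensity M Z t a X = 1 := by
  rcases t with i | j
  · obtain ⟨a, _ | j⟩ := a
    · have hB := (hP.bern_valid i a).missed hM
      exact ⟨hB.density_nonneg, hB.integral_density⟩
    · have h1 : (P.bern i a).detWeight M (Z j) ≠ 0 := hw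
      rw [GaussBern.detWeight_eq] at h1
      have hB := (hP.bern_valid i a).detected hM (right_ne_zero_of_mul h1)
      exact ⟨hB.density_nonneg, hB.integral_density⟩
  · cases a
    · exact absurd rfl hr
    · have h1 : P.vSum M (Z j) / P.newWeight M (Z j) ≠ 0 := hr
      exact ⟨hP.newDensity_nonneg hM (Z j),
        hP.integral_newDensity hM fun h0 => h1 (by rw [h0, zero_div])⟩

theorem GaussPMBM.localWeight_ne_zero {Z : Fin m → TwoStep nz} {b : ∀ t, LocalHyp h m t}
    (hb : P.rawWeight M Z b ≠ 0) (t : Fin n ⊕ Fin m) : P.localWeight M Z t (b t) ≠ 0 :=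
  Finset.prod_ne_zero_iff.1 (right_ne_zero_of_mul hb) t (Finset.mem_univ t)

theorem GaussPMBM.Valid.rawWeight_nonneg (hP : P.Valid) (hM : M.Valid)
    (Z : Fin m → TwoStep nz) {b : ∀ t, LocalHyp h m t} (hb : b ∈ P.updatedHyp m) :
    0 ≤ P.rawWeight M Z b :=
  mul_nonneg (hP.weight_nonneg _ (Finset.mem_filter.1 hb).2.1)
    (Finset.prod_nonneg fun t _ => hP.localWeight_nonneg hM Z t (b t))

theorem GaussPMBM.Valid.integrable_updated_intensity (hP : P.Valid) (Z : Fin m → TwoStep nz) :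
    Integrable (P.updated M Z).intensity := by
  rw [P.updated_intensity]
  exact hP.integrable_intensity.const_mul _

/-- Every component of nonzero raw weight integrates to one, so only the weights remain. They are
the normaliser of the updated weights, and `updateConst` cancels in the posterior. -/
theorem GaussPMBM.Valid.evidence_eq (hP : P.Valid) (hM : M.Valid) (hnx : 0 < nx)
    (hmarg : ∀ i a, (P.bern i a).SameMarginal) (Z : Fin m ↪ TwoStep nz) :
    M.evidence (Finset.univ.map Z) P.predicted.density =
      P.updateConst M * ∑ b ∈ P.updatedHyp m, P.rawWeight M Z b := by
  unfold MeasModel.evidence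
  simp_rw [hP.likelihood_mul_density hM hmarg, Finset.mul_sum, ← mul_assoc]
  refine setIntegral_sum_mul _ _ _ fun b _ hb => ?_
  exact hasUnitSetIntegral_pmb hnx (hP.integrable_updated_intensity Z) _ _ fun t ht =>
    (hP.localDensity_isDensity hM Z t (b t)
      (GaussPMBM.localWeight_ne_zero (right_ne_zero_of_mul hb) t) ht).2

theorem GaussPMBM.updateConst_ne_zero (P : GaussPMBM nx nb np h) (M : MeasModel nx nz) :
    P.updateConst M ≠ 0 := by
  unfold GaussPMBM.updateConst
  positivity

theorem GaussPMBM.updated_density (P : GaussPMBM nx nb np h) (M : MeasModel nx nz)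
    (Z : Fin m → TwoStep nz) (X : Finset (TwoStep nx)) :
    (P.updated M Z).density X = ∑ b ∈ P.updatedHyp m,
      P.rawWeight M Z b / (∑ b' ∈ P.updatedHyp m, P.rawWeight M Z b') *
        P.updatedComponent M Z b X := by
  unfold PMBM.density PMBM.mbmDensity GaussPMBM.updatedComponent conv
  simp_rw [Finset.mul_sum]
  rw [Finset.sum_comm]
  refine Finset.sum_congr rfl fun b _ => Finset.sum_congr rfl fun Y _ => ?_
  exact mul_left_comm _ _ _

theorem GaussPMBM.Valid.posterior_eq (hP : P.Valid) (hM : M.Valid) (hnx : 0 < nx)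
    (hmarg : ∀ i a, (P.bern i a).SameMarginal) (Z : Fin m ↪ TwoStep nz)
    (X : Finset (TwoStep nx)) :
    M.posterior (Finset.univ.map Z) P.predicted.density X = (P.updated M Z).density X := by
  rw [MeasModel.posterior, hP.evidence_eq hM hnx hmarg, hP.likelihood_mul_density hM hmarg,
    mul_div_mul_left _ _ (P.updateConst_ne_zero M), P.updated_density, Finset.sum_div]
  exact Finset.sum_congr rfl fun b _ => mul_div_right_comm _ _ _

theorem GaussPMBM.Valid.updated_isProper (hP : P.Valid) (hM : M.Valid)
    (Z : Fin m → TwoStep nz) (h0 : ∑ b ∈ P.updatedHyp m, P.rawWeight M Z b ≠ 0) :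
    (P.updated M Z).IsProper where
  intensity_nonneg X := by
    rw [P.updated_intensity]
    exact mul_nonneg (sub_nonneg.2 hM.pD_mem.2) (hP.intensity_nonneg X)
  intensity_integrable := hP.integrable_updated_intensity Z
  weight_nonneg b hb := div_nonneg (hP.rawWeight_nonneg hM Z hb)
    (Finset.sum_nonneg fun _ hb' => hP.rawWeight_nonneg hM Z hb')
  weight_sum := by
    change ∑ b ∈ P.updatedHyp m, P.rawWeight M Z b / _ = 1
    rw [← Finset.sum_div, div_self h0]
  r_mem b _ t := hP.localR_mem hM Z t (b t)
  p_nonneg b _ hb t ht := (hP.localDensity_isDensity hM Z t (b t)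
    (GaussPMBM.localWeight_ne_zero (fun hc => hb (by
      change P.rawWeight M Z b / _ = 0
      rw [hc, zero_div])) t) ht).1
  p_integral b _ hb t ht := (hP.localDensity_isDensity hM Z t (b t)
    (GaussPMBM.localWeight_ne_zero (fun hc => hb (by
      change P.rawWeight M Z b / _ = 0
      rw [hc, zero_div])) t) ht).2

/-- The Gaussian approximation of a new density is a component of highest weight. -/
theorem GaussPMBM.Valid.isGaussianApprox_spec (hP : P.Valid) (hM : M.Valid) {Z : TwoStep nz}
    {g : TwoStep nx → ℝ} (hg : P.IsGaussianApprox M Z g) :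
    (∃ c, g = P.newComp M Z c ∧ ∀ c', P.v M Z c' ≤ P.v M Z c) ∧
      (∀ X, 0 ≤ g X) ∧ ∫ X, g X = 1 := by
  have key : ∃ c, g = P.newComp M Z c ∧ ∀ c', P.v M Z c' ≤ P.v M Z c := by
    rcases hg with ⟨q, h1, h2, rfl⟩ | ⟨q, h1, h2, rfl⟩
    · exact ⟨.inl q, rfl, fun c' => c'.rec h1 fun q' => (h2 q').le⟩
    · exact ⟨.inr q, rfl, fun c' => c'.rec (fun q' => (h2 q').le) h1⟩
  refine ⟨key, ?_⟩
  obtain ⟨c, rfl, _⟩ := key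
  exact ⟨P.newComp_nonneg M Z c, hP.integral_newComp hM Z c⟩

end Posterior

end TMPMBM

end

theorem lemma5 {nx nz n m nb np : ℕ} {h : Fin n → ℕ} (hnx : 0 < nx)
    (M : TMPMBM.MeasModel nx nz) (hM : M.Valid)
    (P : TMPMBM.GaussPMBM nx nb np h) (hP : P.Valid)
    -- the two components of every predicted single-trajectory density agree at time k
    (hmarg : ∀ i a, (P.bern i a).SameMarginal)
    (Z : Fin m → TMPMBM.TwoStep nz) (Zs : Finset (TMPMBM.TwoStep nz))
    -- the measurement set is {Z 0, ..., Z (m-1)}, with m distinct elements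
    (hinj : Function.Injective Z) (hZ : (Zs : Set (TMPMBM.TwoStep nz)) = Set.range Z)
    -- the measurement set has nonzero probability density, so that Bayes' rule applies
    (hev : M.evidence Zs P.predicted.density ≠ 0) :
    -- the updated density is a PMBM with the closed-form parameters
    (∀ Xs, M.posterior Zs P.predicted.density Xs = (P.updated M Z).density Xs) ∧
    (P.updated M Z).IsProper ∧
    -- Poisson intensity
    (∀ X, (P.updated M Z).intensity X = (1 - M.pD) * P.predicted.intensity X) ∧
    -- missed detection hypotheses
    (∀ i a, let B := P.bern i a
      B.missedWeight M = 1 - B.r * TMPMBM.innerProd B.density (fun _ => M.pD) ∧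
      (B.missed M).Valid ∧
      (B.missedWeight M ≠ 0 → (B.missed M).r =
        B.r * TMPMBM.innerProd B.density (fun _ => 1 - M.pD) /
          (1 - B.r * TMPMBM.innerProd B.density (fun _ => M.pD))) ∧
      (M.pD ≠ 1 → ∀ X, (B.missed M).density X =
        (1 - M.pD) * B.density X / TMPMBM.innerProd B.density (fun _ => 1 - M.pD))) ∧
    -- detection hypotheses of existing Bernoulli components
    (∀ i a j, let B := P.bern i a
      B.detWeight M (Z j) = B.r * TMPMBM.innerProd B.density (M.lpD (Z j)) ∧
      (TMPMBM.innerProd B.density (M.lpD (Z j)) ≠ 0 →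
        (B.detected M (Z j)).Valid ∧
        ∀ X, (B.detected M (Z j)).density X =
          M.lpD (Z j) X * B.density X / TMPMBM.innerProd B.density (M.lpD (Z j)))) ∧
    -- inner products and Kalman updates of the components of the Poisson intensity
    (∀ j c, P.v M (Z j) c = TMPMBM.innerProd (P.intensityComp c) (M.lpD (Z j)) ∧
      ∀ X, M.lpD (Z j) X * P.intensityComp c X = P.v M (Z j) c * P.newComp M (Z j) c X) ∧
    -- detection hypotheses of new Bernoulli components
    (∀ j, let s := TMPMBM.innerProd P.predicted.intensity (M.lpD (Z j))
      P.newWeight M (Z j) = M.clutter (Z j) + s ∧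
      P.newR M (Z j) = s / (M.clutter (Z j) + s) ∧
      (s ≠ 0 → ∀ X, P.newDensity M (Z j) X =
        M.lpD (Z j) X * P.predicted.intensity X / s)) ∧
    -- the Gaussian approximation of a new density is its component of highest weight
    (∀ j g, P.IsGaussianApprox M (Z j) g →
      (∃ c, g = P.newComp M (Z j) c ∧ ∀ c', P.v M (Z j) c' ≤ P.v M (Z j) c) ∧
      (∀ X, 0 ≤ g X) ∧ ∫ X, g X = 1) := by
  have hZs : Zs = Finset.univ.map ⟨Z, hinj⟩ := by
    apply Finset.coe_injective
    rw [hZ]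
    simp
  subst hZs
  -- Nonzero evidence is what makes the updated global weights normalisable.
  have h0 : ∑ b ∈ P.updatedHyp m, P.rawWeight M Z b ≠ 0 := by
    rw [hP.evidence_eq hM hnx hmarg] at hev
    exact right_ne_zero_of_mul hev
  refine ⟨hP.posterior_eq hM hnx hmarg ⟨Z, hinj⟩, hP.updated_isProper hM Z h0,
    fun X => by rw [P.updated_intensity], fun i a => ?_, fun i a j => ?_, fun j c => ?_,
    fun j => ?_, fun j g hg => hP.isGaussianApprox_spec hM hg⟩
  · have hB := hP.bern_valid i a
    refine ⟨by rw [hB.innerProd_const]; rfl, hB.missed hM, fun _ => ?_, fun hpD X => ?_⟩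
    · rw [hB.innerProd_const, hB.innerProd_const]
      rfl
    · rw [hB.innerProd_const, mul_div_cancel_left₀ _ (sub_ne_zero.2 (Ne.symm hpD))]
      rfl
  · have hB := hP.bern_valid i a
    have hin := hB.innerProd_lpD hM (hmarg i a) (Z j)
    refine ⟨by rw [hin, TMPMBM.GaussBern.detWeight_eq], fun hne => ?_⟩
    rw [hin] at hne ⊢
    refine ⟨hB.detected hM hne, fun X => ?_⟩
    rw [hB.lpD_mul_density hM (hmarg i a), mul_div_cancel_left₀ _ hne]
  · exact ⟨(hP.innerProd_intensityComp hM (Z j) c).symm, hP.lpD_mul_intensityComp hM (Z j) c⟩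
  · have hin := hP.innerProd_intensity hM (Z j)
    refine ⟨by rw [hin]; rfl, by rw [hin]; rfl, fun hne X => ?_⟩
    rw [hin] at hne ⊢
    rw [← hP.vSum_mul_newDensity hM, mul_div_cancel_left₀ _ hne]
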